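/- Let $(D,G)$ be a group pair: $D$ is a connected finite-dimensional real Lie group whose Lie algebra $\mathfrak d$ (with the bracket of right-invariant vector fields) carries a nondegenerate symmetric ad-invariant bilinear form $\langle\cdot,\cdot\rangle$, and $G\subset D$ is a connected closed Lie subgroup whose Lie algebra $\mathfrak g\subset\mathfrak d$ is isotropic with $\dim\mathfrak d=2\dim\mathfrak g$. Let $j:\mathfrak g^*\to\mathfrak d$ be an isotropic splitting, that is, a linear map with $\langle j\mu,j\nu\rangle=0$ and $\langle j\mu,v\rangle=\mu(v)$ for $\mu,\nu\in\mathfrak g^*$, $v\in\mathfrak g$, and put $$F(v)(\mu,\nu)=\langle[j\mu,j\nu],v\rangle,\qquad \chi(\mu,\nu,\lambda)=\langle[j\mu,j\nu],j\lambda\rangle .$$ Let $S=D/G$, with the dressing action of $D$ by left multiplication and infinitesimal action $\rho_S:\mathfrak d\to\mathfrak X(S)$, and let $\sigma^\vee=(\rho_S j)^*:T^*S\to\mathfrak g$. Let $(M,\pi,\rho_M,J)$ be a Hamiltonian quasi-Poisson $G$-space: $M$ is a smooth manifold with a smooth $G$-action, whose infinitesimal action is $\rho_M:\mathfrak g\to\mathfrak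 X(M)$, $\pi$ is a bivector field on $M$ with $$\mathcal L_{\rho_M(v)}\pi=-\rho_M(F(v))\ \ (v\in\mathfrak g),\qquad \tfrac12[\pi,\pi]=\rho_M(\chi),$$ and $J:M\to S$ is a smooth $G$-equivariant map with $\pi^\sharp J^*=\rho_M\sigma^\vee$. Let $y\in S$ be a regular value of $J$ and let $\mathcal O=G\cdot y$ be its dressing orbit. Regard $J^{-1}(\mathcal O)$ as an immersed submanifold of $M$, with the topology of $M\times_S\mathcal O$, where $\mathcal O\cong G/G_y$ carries the quotient topology. Then the algebra $C^\infty(J^{-1}(\mathcal O))^G$ of $G$-invariant smooth functions on $J^{-1}(\mathcal O)$ is a Poisson algebra: there is a unique Poisson bracket on it such that $$\{f,g\}(p)=\pi(d\tilde f,d\tilde g)(p)$$ for all $p\in J^{-1}(\mathcal O)$ and all $\tilde f,\tilde g\in C^\infty(M)$ which agree with $f,g$ on a neighbourhood of $p$ in $J^{-1}(\mathcal O)$; in particular the right-hand side does not depend on the choice of such extensions. Moreover, if the $G$-action on $J^{-1}(\mathcal O)$ is free and proper, then $J^{-1}(\mathcal O)/G$, with the quotient topology, is a Poisson manifold: it has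 the structure of a (Hausdorff, second countable) smooth manifold for which a function is smooth if and only if its pull-back to $J^{-1}(\mathcal O)$ is smooth, and $C^\infty(J^{-1}(\mathcal O)/G)$ carries a unique Poisson bracket such that pull-back to $C^\infty(J^{-1}(\mathcal O))^G$ preserves brackets. -/

import Mathlib

open scoped Manifold ContDiff Topology

noncomputable section

namespace QuasiPoisson

/-! ### Poisson algebras -/

/-- A Poisson bracket on a commutative `ℝ`-algebra: a Lie bracket which is a derivation in each
argument. -/
@[ext]
structure PoissonBracket (A : Type*) [CommRing A] [Algebra ℝ A] where
  bracket : A →ₗ[ℝ] A →ₗ[ℝ] A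
  bracket_self : ∀ f : A, bracket f f = 0
  jacobi : ∀ f g h : A,
    bracket f (bracket g h) + bracket g (bracket h f) + bracket h (bracket f g) = 0
  leibniz : ∀ f g h : A, bracket f (g * h) = bracket f g * h + g * bracket f h

/-! ### Bivector fields on a manifold -/

section Bivector

/-- A smooth bivector field `π` on `M`, given by the bundle map `π♯ : T*M → TM`,
`β (π♯ α) = π (α, β)`. Smoothness is tested on differentials of smooth functions, which span
every cotangent space. -/
structure BivectorField (EM : Type*) [NormedAddCommGroup EM] [NormedSpace ℝ EM]
    (M : Type*) [TopologicalSpace M] [ChartedSpace EM M] where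
  sharp : ∀ x : M, (TangentSpace 𝓘(ℝ, EM) x →L[ℝ] ℝ) →ₗ[ℝ] TangentSpace 𝓘(ℝ, EM) x
  skew : ∀ (x : M) (α : TangentSpace 𝓘(ℝ, EM) x →L[ℝ] ℝ), α (sharp x α) = 0
  smooth : ∀ f g : M → ℝ, ContMDiff 𝓘(ℝ, EM) 𝓘(ℝ, ℝ) ∞ f → ContMDiff 𝓘(ℝ, EM) 𝓘(ℝ, ℝ) ∞ g →
    ContMDiff 𝓘(ℝ, EM) 𝓘(ℝ, ℝ) ∞
      (fun x => mvfderiv 𝓘(ℝ, EM) g x (sharp x (mvfderiv 𝓘(ℝ, EM) f x)))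

variable {EM : Type*} [NormedAddCommGroup EM] [NormedSpace ℝ EM]
  {M : Type*} [TopologicalSpace M] [ChartedSpace EM M]

/-- The function `{f, g} = π (df, dg)`. -/
def BivectorField.bracket (π : BivectorField EM M) (f g : M → ℝ) : M → ℝ :=
  fun x => mvfderiv 𝓘(ℝ, EM) g x (π.sharp x (mvfderiv 𝓘(ℝ, EM) f x))

/-- The derivative `X f` of a function along a vector field. -/
def derivAlong (X : ∀ x : M, TangentSpace 𝓘(ℝ, EM) x) (f : M → ℝ) : M → ℝ :=
  fun x => mvfderiv 𝓘(ℝ, EM) f x (X x)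

/-- The value `(𝓛_X π) (df, dg) = X (π (df, dg)) - π (d (X f), dg) - π (df, d (X g))` of the Lie
derivative of a bivector field. -/
def BivectorField.lieDerivative (π : BivectorField EM M)
    (X : ∀ x : M, TangentSpace 𝓘(ℝ, EM) x) (f g : M → ℝ) : M → ℝ :=
  derivAlong X (π.bracket f g) - π.bracket (derivAlong X f) g - π.bracket f (derivAlong X g)

/-- The value `[π, τ] (df, dg, dh)` of the Schouten bracket of two bivector fields; in particular
`½ [π, π] (df, dg, dh) = {f, {g, h}} + {g, {h, f}} + {h, {f, g}}`. -/
def BivectorField.schouten (π τ : BivectorField EM M) (f g h : M → ℝ) : M → ℝ :=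
  π.bracket f (τ.bracket g h) + π.bracket g (τ.bracket h f) + π.bracket h (τ.bracket f g)
    + (τ.bracket f (π.bracket g h) + τ.bracket g (π.bracket h f) + τ.bracket h (π.bracket f g))

end Bivector

/-! ### The Lie algebra of a Lie group, and fundamental vector fields -/

section LieAlgebra

variable {ED : Type*} [NormedAddCommGroup ED] [NormedSpace ℝ ED]
  {D : Type*} [TopologicalSpace D] [ChartedSpace ED D] [Group D]

/-- The right-invariant vector field `a ↦ d(r_a) u` of `u ∈ T_1 D`. -/
def rightInvariantField (u : GroupLieAlgebra 𝓘(ℝ, ED) D) (a : D) :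
    TangentSpace 𝓘(ℝ, ED) a :=
  mfderiv 𝓘(ℝ, ED) 𝓘(ℝ, ED) (fun b : D => b * a) 1 u

/-- The Lie bracket on `T_1 D` obtained from *right*-invariant vector fields (so that the
fundamental vector fields of a left action form a Lie algebra homomorphism). It is minus Mathlib's
bracket on `GroupLieAlgebra`, which uses left-invariant vector fields. -/
def lieBracketR (u v : GroupLieAlgebra 𝓘(ℝ, ED) D) : GroupLieAlgebra 𝓘(ℝ, ED) D :=
  VectorField.mlieBracket 𝓘(ℝ, ED) (rightInvariantField u) (rightInvariantField v) (1 : D)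

variable {EM : Type*} [NormedAddCommGroup EM] [NormedSpace ℝ EM]
  {M : Type*} [TopologicalSpace M] [ChartedSpace EM M] [MulAction D M]

variable (ED D EM) in
/-- The infinitesimal action at `x`: `u ↦ d/dt|₀ exp (t u) • x`, i.e. the derivative at `1` of
the orbit map `a ↦ a • x`. -/
def infAction (x : M) : GroupLieAlgebra 𝓘(ℝ, ED) D →L[ℝ] TangentSpace 𝓘(ℝ, EM) x :=
  mfderiv 𝓘(ℝ, ED) 𝓘(ℝ, EM) (fun a : D => a • x) 1

end LieAlgebra

instance {EG : Type*} [NormedAddCommGroup EG] [NormedSpace ℝ EG] [FiniteDimensional ℝ EG]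
    {G : Type*} [TopologicalSpace G] [ChartedSpace EG G] (x : G) :
    FiniteDimensional ℝ (TangentSpace 𝓘(ℝ, EG) x) :=
  inferInstanceAs (FiniteDimensional ℝ EG)

/-! ### Split Manin pairs, integrated by group pairs -/

/-- The derivative at the identity of a group homomorphism. -/
def lieMap {EG : Type*} [NormedAddCommGroup EG] [NormedSpace ℝ EG]
    {G : Type*} [TopologicalSpace G] [ChartedSpace EG G] [Group G]
    {ED : Type*} [NormedAddCommGroup ED] [NormedSpace ℝ ED]
    {D : Type*} [TopologicalSpace D] [ChartedSpace ED D] [Group D] (φ : G →* D) :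
    GroupLieAlgebra 𝓘(ℝ, EG) G →L[ℝ] GroupLieAlgebra 𝓘(ℝ, ED) D :=
  mfderiv 𝓘(ℝ, EG) 𝓘(ℝ, ED) φ 1

/-- A split Manin pair `(𝔡, 𝔤, j)` together with a group pair `(D, G)` integrating it:
`G` is a closed Lie subgroup of `D` (via `incl`), `𝔡 = Lie D` carries a nondegenerate symmetric
invariant bilinear form, `𝔤 = Lie G` is isotropic of half the dimension (so that the form has
signature `(n, n)` and `𝔤` is maximal isotropic), and `j : 𝔤* → 𝔡` is an isotropic
splitting of `𝔤 → 𝔡 → 𝔤*`. -/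
structure SplitManinPair (ED : Type*) [NormedAddCommGroup ED] [NormedSpace ℝ ED]
    (D : Type*) [TopologicalSpace D] [ChartedSpace ED D] [Group D]
    (EG : Type*) [NormedAddCommGroup EG] [NormedSpace ℝ EG]
    (G : Type*) [TopologicalSpace G] [ChartedSpace EG G] [Group G] where
  incl : G →* D
  incl_smooth : ContMDiff 𝓘(ℝ, EG) 𝓘(ℝ, ED) ∞ incl
  incl_closed : Topology.IsClosedEmbedding incl
  incl_immersion : Function.Injective
    (lieMap incl : GroupLieAlgebra 𝓘(ℝ, EG) G →L[ℝ] GroupLieAlgebra 𝓘(ℝ, ED) D)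
  form : LinearMap.BilinForm ℝ (GroupLieAlgebra 𝓘(ℝ, ED) D)
  form_symm : form.IsSymm
  form_nondegenerate : form.Nondegenerate
  form_invariant : ∀ u v w : GroupLieAlgebra 𝓘(ℝ, ED) D,
    form (lieBracketR u v) w = form u (lieBracketR v w)
  isotropic : ∀ u v : GroupLieAlgebra 𝓘(ℝ, EG) G, form (lieMap incl u) (lieMap incl v) = 0
  finrank_eq : Module.finrank ℝ ED = 2 * Module.finrank ℝ EG
  j : Module.Dual ℝ (GroupLieAlgebra 𝓘(ℝ, EG) G) →ₗ[ℝ] GroupLieAlgebra 𝓘(ℝ, ED) D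
  j_isotropic : ∀ μ ν, form (j μ) (j ν) = 0
  j_splitting : ∀ (μ : Module.Dual ℝ (GroupLieAlgebra 𝓘(ℝ, EG) G))
    (v : GroupLieAlgebra 𝓘(ℝ, EG) G), form (j μ) (lieMap incl v) = μ v

namespace SplitManinPair

variable {ED : Type*} [NormedAddCommGroup ED] [NormedSpace ℝ ED]
  {D : Type*} [TopologicalSpace D] [ChartedSpace ED D] [Group D]
  {EG : Type*} [NormedAddCommGroup EG] [NormedSpace ℝ EG]
  {G : Type*} [TopologicalSpace G] [ChartedSpace EG G] [Group G]
  (P : SplitManinPair ED D EG G)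

/-- The cobracket: `F(v) (μ, ν) = ⟨v, F*(μ, ν)⟩` with `F*(μ, ν) = ι* [j μ, j ν]`. -/
def cobracket (v : GroupLieAlgebra 𝓘(ℝ, EG) G)
    (μ ν : Module.Dual ℝ (GroupLieAlgebra 𝓘(ℝ, EG) G)) : ℝ :=
  P.form (lieBracketR (P.j μ) (P.j ν)) (lieMap P.incl v)

/-- The trivector `χ (μ, ν, lam) = ⟨j* [j μ, j ν], lam⟩ = ⟨[j μ, j ν], j lam⟩`. -/
def trivector (μ ν lam : Module.Dual ℝ (GroupLieAlgebra 𝓘(ℝ, EG) G)) : ℝ :=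
  P.form (lieBracketR (P.j μ) (P.j ν)) (P.j lam)

/-- The space `S = D / G` of left cosets `a G`, with the quotient topology and the dressing action
of `D` by left multiplication. -/
abbrev S : Type _ := D ⧸ P.incl.range

/-- The map `σ^∨ = (ρ_S ∘ j)* : T*_s S → 𝔤** = 𝔤`. -/
def sigmaDual [FiniteDimensional ℝ EG] {ES : Type*} [NormedAddCommGroup ES] [NormedSpace ℝ ES]
    [ChartedSpace ES P.S] (s : P.S) (α : TangentSpace 𝓘(ℝ, ES) s →L[ℝ] ℝ) :
    GroupLieAlgebra 𝓘(ℝ, EG) G :=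
  (Module.evalEquiv ℝ (GroupLieAlgebra 𝓘(ℝ, EG) G)).symm
    (α.toLinearMap ∘ₗ (infAction ED D ES s).toLinearMap ∘ₗ P.j)

/-- The `G`-orbit of `y` under the dressing action. -/
def DressingOrbit (y : P.S) : Type _ := {s : P.S // ∃ g : G, P.incl g • y = s}

/-- The dressing orbit is an immersed, possibly not embedded, submanifold `G / G_y` of `S`. It is
given its own topology, the quotient topology along the orbit map `G → 𝒪`. -/
instance (y : P.S) : TopologicalSpace (P.DressingOrbit y) :=
  TopologicalSpace.coinduced (fun g : G => (⟨P.incl g • y, g, rfl⟩ : P.DressingOrbit y))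
    inferInstance

end SplitManinPair

/-! ### Hamiltonian quasi-Poisson spaces -/

/-- A Hamiltonian quasi-Poisson `G`-space `(M, π, ρ_M, J)` for the split Manin pair `P`; the
action `ρ_M` of `𝔤` is the infinitesimal action of the `G`-action on `M`. -/
structure HamiltonianSpace {ED : Type*} [NormedAddCommGroup ED] [NormedSpace ℝ ED]
    {D : Type*} [TopologicalSpace D] [ChartedSpace ED D] [Group D]
    {EG : Type*} [NormedAddCommGroup EG] [NormedSpace ℝ EG] [FiniteDimensional ℝ EG]
    {G : Type*} [TopologicalSpace G] [ChartedSpace EG G] [Group G]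
    (P : SplitManinPair ED D EG G)
    (ES : Type*) [NormedAddCommGroup ES] [NormedSpace ℝ ES] [ChartedSpace ES P.S]
    (EM : Type*) [NormedAddCommGroup EM] [NormedSpace ℝ EM]
    (M : Type*) [TopologicalSpace M] [ChartedSpace EM M] [MulAction G M] where
  π : BivectorField EM M
  /-- `𝓛_{ρ_M(v)} π = - ρ_M(F(v))` -/
  lie_eq : ∀ (v : GroupLieAlgebra 𝓘(ℝ, EG) G) (f g : M → ℝ),
    ContMDiff 𝓘(ℝ, EM) 𝓘(ℝ, ℝ) ∞ f → ContMDiff 𝓘(ℝ, EM) 𝓘(ℝ, ℝ) ∞ g → ∀ x : M,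
    π.lieDerivative (fun x => infAction EG G EM x v) f g x =
      - P.cobracket v (mvfderiv 𝓘(ℝ, EM) f x ∘L infAction EG G EM x).toLinearMap
          (mvfderiv 𝓘(ℝ, EM) g x ∘L infAction EG G EM x).toLinearMap
  /-- `½ [π, π] = ρ_M(χ)` -/
  schouten_eq : ∀ f g h : M → ℝ,
    ContMDiff 𝓘(ℝ, EM) 𝓘(ℝ, ℝ) ∞ f → ContMDiff 𝓘(ℝ, EM) 𝓘(ℝ, ℝ) ∞ g →
    ContMDiff 𝓘(ℝ, EM) 𝓘(ℝ, ℝ) ∞ h → ∀ x : M,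
    (1 / 2 : ℝ) * π.schouten π f g h x =
      P.trivector (mvfderiv 𝓘(ℝ, EM) f x ∘L infAction EG G EM x).toLinearMap
        (mvfderiv 𝓘(ℝ, EM) g x ∘L infAction EG G EM x).toLinearMap
        (mvfderiv 𝓘(ℝ, EM) h x ∘L infAction EG G EM x).toLinearMap
  /-- The moment map. -/
  J : M → P.S
  J_smooth : ContMDiff 𝓘(ℝ, EM) 𝓘(ℝ, ES) ∞ J
  J_equivariant : ∀ (g : G) (x : M), J (g • x) = P.incl g • J x
  /-- `π♯ J* = ρ_M σ^∨` -/
  moment : ∀ (x : M) (α : TangentSpace 𝓘(ℝ, ES) (J x) →L[ℝ] ℝ),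
    π.sharp x (α ∘L mfderiv 𝓘(ℝ, EM) 𝓘(ℝ, ES) J x) =
      infAction EG G EM x (P.sigmaDual (J x) α)

namespace HamiltonianSpace

variable {ED : Type*} [NormedAddCommGroup ED] [NormedSpace ℝ ED]
  {D : Type*} [TopologicalSpace D] [ChartedSpace ED D] [Group D]
  {EG : Type*} [NormedAddCommGroup EG] [NormedSpace ℝ EG] [FiniteDimensional ℝ EG]
  {G : Type*} [TopologicalSpace G] [ChartedSpace EG G] [Group G]
  {P : SplitManinPair ED D EG G}
  {ES : Type*} [NormedAddCommGroup ES] [NormedSpace ℝ ES] [ChartedSpace ES P.S]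
  {EM : Type*} [NormedAddCommGroup EM] [NormedSpace ℝ EM]
  {M : Type*} [TopologicalSpace M] [ChartedSpace EM M] [MulAction G M]
  (H : HamiltonianSpace P ES EM M)

/-- `y` is a regular value of `J`. -/
def IsRegularValue (y : P.S) : Prop :=
  ∀ x : M, H.J x = y → Function.Surjective (mfderiv 𝓘(ℝ, EM) 𝓘(ℝ, ES) H.J x)

/-- The preimage `J⁻¹(𝒪)` of the dressing orbit `𝒪` of `y`. -/
def Preimage (y : P.S) : Type _ := {x : M // ∃ g : G, P.incl g • y = H.J x}

/-- The restriction `J : J⁻¹(𝒪) → 𝒪`. -/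
def toOrbit (y : P.S) (p : H.Preimage y) : P.DressingOrbit y := ⟨H.J p.1, p.2⟩

/-- The topology of `J⁻¹(𝒪)` as an immersed submanifold, namely as the fibre product
`M ×_S 𝒪`. If `𝒪` is embedded in `S` this is the subspace topology. -/
instance (y : P.S) : TopologicalSpace (H.Preimage y) :=
  TopologicalSpace.induced Subtype.val inferInstance ⊓
    TopologicalSpace.induced (H.toOrbit y) inferInstance

/-- `G` acts on `J⁻¹(𝒪)` by restriction of its action on `M`. -/
instance (y : P.S) : MulAction G (H.Preimage y) where
  smul g p := ⟨g • p.1, by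
    obtain ⟨h, hh⟩ := p.2
    exact ⟨g * h, by rw [map_mul, mul_smul, hh, H.J_equivariant]⟩⟩
  one_smul p := Subtype.ext (one_smul G p.1)
  mul_smul g h p := Subtype.ext (mul_smul g h p.1)

variable {H} in
/-- `F` is a smooth function on `M` which extends `f : J⁻¹(𝒪) → ℝ` near `p`: it agrees with `f`
on a neighbourhood of `p` in the immersed submanifold `J⁻¹(𝒪)`. -/
def IsExtensionAt {y : P.S} (F : M → ℝ) (f : H.Preimage y → ℝ) (p : H.Preimage y) : Prop :=
  ContMDiff 𝓘(ℝ, EM) 𝓘(ℝ, ℝ) ∞ F ∧ ∀ᶠ q in 𝓝 p, F q.1 = f q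

variable {H} in
/-- Smooth functions on the immersed submanifold `J⁻¹(𝒪)` of `M`: those which locally, in the
topology of `J⁻¹(𝒪)`, are restrictions of smooth functions on `M`. -/
def IsSmooth {y : P.S} (f : H.Preimage y → ℝ) : Prop :=
  ∀ p : H.Preimage y, ∃ F : M → ℝ, IsExtensionAt F f p

/-- The algebra `C^∞(J⁻¹(𝒪))^G` of `G`-invariant smooth functions. -/
def invariantFunctions (y : P.S) : Subalgebra ℝ (H.Preimage y → ℝ) where
  carrier := {f | IsSmooth f ∧ ∀ (g : G) (p : H.Preimage y), f (g • p) = f p}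
  mul_mem' := by
    rintro f g ⟨hf, hf'⟩ ⟨hg, hg'⟩
    refine ⟨fun p => ?_, fun a p => by simp only [Pi.mul_apply, hf', hg']⟩
    obtain ⟨F, hF, hF'⟩ := hf p
    obtain ⟨K, hK, hK'⟩ := hg p
    refine ⟨F * K, hF.mul hK, ?_⟩
    filter_upwards [hF', hK'] with q h1 h2
    simp only [Pi.mul_apply, h1, h2]
  add_mem' := by
    rintro f g ⟨hf, hf'⟩ ⟨hg, hg'⟩
    refine ⟨fun p => ?_, fun a p => by simp only [Pi.add_apply, hf', hg']⟩
    obtain ⟨F, hF, hF'⟩ := hf p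
    obtain ⟨K, hK, hK'⟩ := hg p
    refine ⟨F + K, hF.add hK, ?_⟩
    filter_upwards [hF', hK'] with q h1 h2
    simp only [Pi.add_apply, h1, h2]
  algebraMap_mem' := fun c =>
    ⟨fun _ => ⟨fun _ => c, contMDiff_const, Filter.Eventually.of_forall fun _ => rfl⟩,
      fun _ _ => rfl⟩

/-- A Poisson bracket on `C^∞(J⁻¹(𝒪))^G` is the reduced one if `{f, g} = π (dF, dK)` at every
point of `J⁻¹(𝒪)`, for *all* extensions `F`, `K` of `f`, `g` near that point. -/
def IsReducedBracket {y : P.S} (br : PoissonBracket (H.invariantFunctions y)) : Prop :=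
  ∀ (f g : H.invariantFunctions y) (p : H.Preimage y) (F K : M → ℝ),
    IsExtensionAt F f.1 p → IsExtensionAt K g.1 p →
      (br.bracket f g).1 p = H.π.bracket F K p.1

/-- The quotient `J⁻¹(𝒪) / G`, with the quotient topology. -/
abbrev ReducedSpace (y : P.S) : Type _ := MulAction.orbitRel.Quotient G (H.Preimage y)

/-- The projection `J⁻¹(𝒪) → J⁻¹(𝒪) / G`. -/
def proj {y : P.S} (p : H.Preimage y) : H.ReducedSpace y := Quotient.mk _ p

end HamiltonianSpace

end QuasiPoisson

end

/-! Write C for J⁻¹(𝒪). By equivariance every point of C is regular for J. If F is smooth on M and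
vanishes on C near p, it vanishes on the fibre of J through p, so dF kills ker dJ and dF = α ∘ dJ
for some covector α on S. The moment condition then says that π♯ dF = ρ_M(σ^∨ α) is tangent to the
G-orbit, and the differential of any extension of an invariant function annihilates it. Hence π(dF,
dK) depends only on the restrictions (`bracket_eq_zero`, `bracket_congr`).

The two defects of a quasi-Poisson structure act through ρ_M, and covectors dF with F extending an
invariant function vanish on ρ_M(𝔤). So F(v) contributes nothing to 𝓛π and the bracket of extensions
is constant along orbits, first infinitesimally, then locally, then globally because G is connected
(`reducedFun_smul`). Likewise χ contributes nothing to ½[π, π], which is the Jacobi identity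
(`reducedFun_jacobi`).

For the quotient, no manifold structure on C is constructed; everything is read off from M. Near p
over y the fibre J⁻¹(y) is parametrized by ker dJ. A complement in ker dJ to the directions of the
isotropy algebra 𝔤_y gives a slice of dimension dim M - dim S - dim 𝔤_y. The slice and G_y sweep out
the fibre near p, and since G → 𝒪 is open, the slice and G sweep out a neighbourhood in C
(`exists_fibre_slice`, `exists_slice`). Freeness and properness make a small slice meet each orbit
at most once, so slices are charts of C/G. A local retraction, smooth on an open set of M, recovers
the slice parameter; this makes transition maps smooth and identifies C^∞(C/G) with C^∞(C)^G, along
which the bracket is transported.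

The differential-geometric input is the inverse function theorem and the constant rank theorem
derived from it; applied to orbit maps, the latter parametrizes isotropy groups without an
exponential map. -/

namespace QuasiPoisson
-- Inverse function and constant rank theorems in vector spaces.
section Analysis

set_option linter.unusedSectionVars false

variable {E F : Type*} [NormedAddCommGroup E] [NormedSpace ℝ E] [FiniteDimensional ℝ E]
  [NormedAddCommGroup F] [NormedSpace ℝ F] [FiniteDimensional ℝ F]

/-- The smooth inverse function theorem, with smoothness on whole neighbourhoods. -/
theorem exists_openPartialHomeomorph_of_hasFDerivAt_equiv {f : E → F} {a : E} (f' : E ≃L[ℝ] F)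
    (hf : ∀ᶠ x in 𝓝 a, ContDiffAt ℝ ∞ f x) (hf' : HasFDerivAt f (f' : E →L[ℝ] F) a) :
    ∃ e : OpenPartialHomeomorph E F, (∀ x, e x = f x) ∧ a ∈ e.source ∧
      (∀ x ∈ e.source, ContDiffAt ℝ ∞ f x) ∧
      (∀ y ∈ e.target, ContDiffAt ℝ ∞ e.symm y) ∧
      HasFDerivAt e.symm (f'.symm : F →L[ℝ] E) (f a) := by
  have hfa : ContDiffAt ℝ ∞ f a := hf.self_of_nhds
  set e₀ := hfa.toOpenPartialHomeomorph f hf' (by simp) with he₀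
  have hcont : ContinuousAt (fderiv ℝ f) a :=
    (hfa.fderiv_right (m := 0) (by simp)).continuousAt
  have hinv : ∀ᶠ x in 𝓝 a, ∃ A : E ≃L[ℝ] F, (A : E →L[ℝ] F) = fderiv ℝ f x := by
    have := hcont.eventually (f := fderiv ℝ f)
      (p := fun T => ∃ A : E ≃L[ℝ] F, (A : E →L[ℝ] F) = T) (by
        rw [hf'.fderiv]; exact f'.nhds)
    exact this
  obtain ⟨s, hs, hso, has⟩ := eventually_nhds_iff.1 (hf.and hinv)
  have hmem : a ∈ e₀.source := hfa.mem_toOpenPartialHomeomorph_source hf' (by simp)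
  have hcoe : ∀ x, e₀ x = f x := fun x => rfl
  -- On `s` the map is smooth with invertible derivative, so restricting to `s` makes the inverse
  -- smooth at every point of the target and not only at `f a`.
  refine ⟨e₀.restrOpen s hso, fun x => rfl, ⟨hmem, has⟩, fun x hx => (hs x hx.2).1, ?_, ?_⟩
  · intro y hy
    have hx := (e₀.restrOpen s hso).map_target hy
    obtain ⟨h1, A, hA⟩ := hs _ hx.2
    refine (e₀.restrOpen s hso).contDiffAt_symm hy (f₀' := A) ?_ h1
    rw [hA]
    exact (h1.differentiableAt (by simp)).hasFDerivAt
  · have h1 : e₀.symm (f a) = a := e₀.left_inv hmem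
    refine (e₀.restrOpen s hso).hasFDerivAt_symm (a := f a) ?_ ?_
    · exact (e₀.restrOpen s hso).map_source ⟨hmem, has⟩
    · change HasFDerivAt f _ (e₀.symm (f a))
      rw [h1]; exact hf'

theorem exists_leftInverse_of_injective {T : E →L[ℝ] F} (hT : Function.Injective T) :
    ∃ A : F →L[ℝ] E, ∀ v, A (T v) = v := by
  obtain ⟨A, hA⟩ := LinearMap.exists_leftInverse_of_injective T.toLinearMap
    (LinearMap.ker_eq_bot.2 hT)
  exact ⟨A.toContinuousLinearMap, fun v => LinearMap.congr_fun hA v⟩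

theorem exists_rightInverse_of_surjective {T : E →L[ℝ] F} (hT : Function.Surjective T) :
    ∃ B : F →L[ℝ] E, ∀ w, T (B w) = w := by
  obtain ⟨B, hB⟩ := LinearMap.exists_rightInverse_of_surjective T.toLinearMap
    (LinearMap.range_eq_top.2 hT)
  exact ⟨B.toContinuousLinearMap, fun w => LinearMap.congr_fun hB w⟩

/-- A map with surjective derivative has a smooth local section. -/
theorem exists_local_section {f : E → F} {a : E} {f' : E →L[ℝ] F}
    (hf : ∀ᶠ x in 𝓝 a, ContDiffAt ℝ ∞ f x) (hf' : HasFDerivAt f f' a)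
    (hsurj : Function.Surjective f') :
    ∃ s : F → E, s (f a) = a ∧ (∀ᶠ y in 𝓝 (f a), ContDiffAt ℝ ∞ s y) ∧
      ∀ᶠ y in 𝓝 (f a), f (s y) = y := by
  obtain ⟨B, hB⟩ := exists_rightInverse_of_surjective hsurj
  -- On the affine subspace through `a` spanned by a right inverse `B` of the derivative, `f` has
  -- derivative the identity and can be inverted.
  set ι : F → E := fun w => a + B w with hι
  have hι0 : ι 0 = a := by simp [hι]
  have hιs : ContDiff ℝ ∞ ι := contDiff_const.add B.contDiff
  have hιd : HasFDerivAt ι B 0 := B.hasFDerivAt.const_add a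
  have h1 : ∀ᶠ w in 𝓝 (0 : F), ContDiffAt ℝ ∞ (fun w => f (ι w)) w := by
    have : ContinuousAt ι 0 := hιs.continuous.continuousAt
    filter_upwards [this.eventually (by rw [hι0]; exact hf)] with w hw
    exact hw.comp w hιs.contDiffAt
  have h2 : HasFDerivAt (fun w => f (ι w))
      ((ContinuousLinearEquiv.refl ℝ F : F ≃L[ℝ] F) : F →L[ℝ] F) 0 := by
    have h3 : HasFDerivAt f f' (ι 0) := by rwa [hι0]
    refine (h3.comp (0 : F) hιd).congr_fderiv ?_
    ext w
    simp [hB]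
  obtain ⟨e, he, h0, -, hsm, -⟩ := exists_openPartialHomeomorph_of_hasFDerivAt_equiv _ h1 h2
  have hfa : f a ∈ e.target := by
    have := e.map_source h0
    rwa [he, hι0] at this
  refine ⟨fun y => ι (e.symm y), ?_, ?_, ?_⟩
  · have : e.symm (f a) = 0 := by
      have := e.left_inv h0
      rwa [he, hι0] at this
    simp [this, hι]
  · filter_upwards [e.open_target.mem_nhds hfa] with y hy
    exact hιs.contDiffAt.comp y (hsm y hy)
  · filter_upwards [e.open_target.mem_nhds hfa] with y hy
    rw [← he, e.right_inv hy]

/-- A map with injective derivative has a smooth local retraction. -/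
theorem exists_local_retraction {f : E → F} {a : E} {f' : E →L[ℝ] F}
    (hf : ∀ᶠ x in 𝓝 a, ContDiffAt ℝ ∞ f x) (hf' : HasFDerivAt f f' a)
    (hinj : Function.Injective f') :
    ∃ r : F → E, (∀ᶠ y in 𝓝 (f a), ContDiffAt ℝ ∞ r y) ∧ ∀ᶠ x in 𝓝 a, r (f x) = x := by
  obtain ⟨A, hA⟩ := exists_leftInverse_of_injective hinj
  have h1 : ∀ᶠ x in 𝓝 a, ContDiffAt ℝ ∞ (fun x => A (f x)) x := by
    filter_upwards [hf] with x hx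
    exact A.contDiff.contDiffAt.comp x hx
  have h2 : HasFDerivAt (fun x => A (f x))
      ((ContinuousLinearEquiv.refl ℝ E : E ≃L[ℝ] E) : E →L[ℝ] E) a := by
    refine (A.hasFDerivAt.comp a hf').congr_fderiv ?_
    ext w
    simp [hA]
  obtain ⟨e, he, h0, -, hsm, -⟩ := exists_openPartialHomeomorph_of_hasFDerivAt_equiv _ h1 h2
  have hmem : A (f a) ∈ e.target := by simpa [he] using e.map_source h0
  refine ⟨fun y => e.symm (A y), ?_, ?_⟩
  · have : ContinuousAt A (f a) := A.continuous.continuousAt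
    filter_upwards [this (e.open_target.mem_nhds hmem)] with y hy
    exact (hsm _ hy).comp y A.contDiff.contDiffAt
  · filter_upwards [e.open_source.mem_nhds h0] with x hx
    rw [← he, e.left_inv hx]

/-- Balls are convex, so vanishing of the derivative on one suffices. It serves both the constant
rank theorem and the local invariance of the bracket. -/
theorem eventually_eq_of_fderiv_eq_zero {f : E → F} {a : E}
    (hf : ∀ᶠ x in 𝓝 a, DifferentiableAt ℝ f x) (hf' : ∀ᶠ x in 𝓝 a, fderiv ℝ f x = 0) :
    ∀ᶠ x in 𝓝 a, f x = f a := by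
  obtain ⟨ε, hε, hball⟩ := Metric.eventually_nhds_iff_ball.1 (hf.and hf')
  filter_upwards [Metric.ball_mem_nhds a hε] with x hx
  exact Metric.isOpen_ball.is_const_of_fderiv_eq_zero (convex_ball a ε).isPreconnected
    (fun z hz => (hball z hz).1.differentiableWithinAt) (fun z hz => (hball z hz).2) hx
    (Metric.mem_ball_self hε)

/-- The constant rank theorem: near `a`, the fibre of `f` through `a` is parametrized by the kernel
`K` of the derivative. -/
theorem exists_fibre_parametrization {f : E → F} {a : E} (K : Submodule ℝ E)
    (hK : ∀ w, w ∈ K ↔ fderiv ℝ f a w = 0)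
    (hf : ∀ᶠ x in 𝓝 a, ContDiffAt ℝ ∞ f x)
    (hrank : ∀ᶠ x in 𝓝 a, Module.finrank ℝ K ≤
      Module.finrank ℝ (LinearMap.ker (fderiv ℝ f x).toLinearMap)) :
    ∃ (κ : K → E) (A : E →L[ℝ] K), κ 0 = a ∧ (∀ᶠ t in 𝓝 0, ContDiffAt ℝ ∞ κ t) ∧
      HasFDerivAt κ K.subtypeL 0 ∧ (∀ᶠ t in 𝓝 0, f (κ t) = f a) ∧
      (∀ᶠ t in 𝓝 0, A (κ t - a) = t) ∧ ∀ᶠ x in 𝓝 a, f x = f a → κ (A (x - a)) = x := by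
  set f'a := fderiv ℝ f a with hf'a
  set R := LinearMap.range f'a.toLinearMap with hR
  obtain ⟨P, hP⟩ := exists_leftInverse_of_injective (T := R.subtypeL) R.injective_subtype
  obtain ⟨A, hA⟩ := exists_leftInverse_of_injective (T := K.subtypeL) K.injective_subtype
  have hfa := hf.self_of_nhds
  have hda : HasFDerivAt f f'a a := (hfa.differentiableAt (by simp)).hasFDerivAt
  -- `P` projects onto the range of the derivative and `A` onto its kernel; by rank-nullity `g` has
  -- invertible derivative at `a`. In the coordinates `g` the fibre will be the locus where the
  -- first component is zero.
  set g : E → R × K := fun x => (P (f x - f a), A (x - a)) with hg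
  have hgs : ∀ᶠ x in 𝓝 a, ContDiffAt ℝ ∞ g x := by
    filter_upwards [hf] with x hx
    exact (P.contDiff.contDiffAt.comp x (hx.sub contDiffAt_const)).prodMk
      (A.contDiff.contDiffAt.comp x (contDiffAt_id.sub contDiffAt_const))
  have hgd : ∀ x, DifferentiableAt ℝ f x →
      HasFDerivAt g ((P ∘L fderiv ℝ f x).prod A) x := by
    intro x hx
    exact (P.hasFDerivAt.comp x (hx.hasFDerivAt.sub_const (f a))).prodMk
      (A.hasFDerivAt.comp x ((hasFDerivAt_id x).sub_const a))
  have hPf : ∀ w, ((P (f'a w) : R) : F) = f'a w := by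
    intro w
    have := hP ⟨f'a w, w, rfl⟩
    exact congrArg Subtype.val this
  have hkerK : LinearMap.ker f'a.toLinearMap = K := by
    ext w; rw [hK]; rfl
  have hinj : Function.Injective ((P ∘L f'a).prod A) := by
    rw [injective_iff_map_eq_zero]
    intro w hw
    have h1 : P (f'a w) = 0 := congrArg Prod.fst hw
    have h2 : A w = 0 := congrArg Prod.snd hw
    have h3 : f'a w = 0 := by rw [← hPf, h1]; rfl
    have h4 := hA ⟨w, (hK w).2 h3⟩
    have h5 : A w = ⟨w, (hK w).2 h3⟩ := h4
    rw [h2] at h5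
    exact (congrArg Subtype.val h5).symm
  have hdim : Module.finrank ℝ E = Module.finrank ℝ (R × K) := by
    rw [Module.finrank_prod, ← LinearMap.finrank_range_add_finrank_ker f'a.toLinearMap, hkerK]
  set eq : E ≃L[ℝ] R × K :=
    (LinearEquiv.ofInjectiveOfFinrankEq ((P ∘L f'a).prod A).toLinearMap hinj hdim).toContinuousLinearEquiv
    with heq
  have heqc : (eq : E →L[ℝ] R × K) = (P ∘L f'a).prod A := by
    ext w <;> rfl
  obtain ⟨e, he, hae, -, hsm, hsd⟩ := exists_openPartialHomeomorph_of_hasFDerivAt_equiv eq hgs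
    (by rw [heqc]; exact hgd a hda.differentiableAt)
  have hga : g a = 0 := by simp [hg]
  set κ : K → E := fun t => e.symm (0, t) with hκ
  have hκ0 : κ 0 = a := by
    have := e.left_inv hae
    rwa [he, hga] at this
  have h0t : (0 : R × K) ∈ e.target := by
    have := e.map_source hae
    rwa [he, hga] at this
  have hin : ContDiff ℝ ∞ (fun t : K => ((0 : R), t)) := contDiff_const.prodMk contDiff_id
  have hev : ∀ᶠ t in 𝓝 (0 : K), ((0 : R), t) ∈ e.target :=
    hin.continuous.continuousAt (e.open_target.mem_nhds h0t)
  have hκs : ∀ᶠ t in 𝓝 (0 : K), ContDiffAt ℝ ∞ κ t := by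
    filter_upwards [hev] with t ht
    exact (hsm _ ht).comp t hin.contDiffAt
  have hκc : ContinuousAt κ 0 := hκs.self_of_nhds.continuousAt
  have hgκ : ∀ᶠ t in 𝓝 (0 : K), g (κ t) = (0, t) := by
    filter_upwards [hev] with t ht
    rw [← he, e.right_inv ht]
  refine ⟨κ, A, hκ0, hκs, ?_, ?_, ?_, ?_⟩
  · rw [hga] at hsd
    have h1 : HasFDerivAt (fun t : K => ((0 : R), t)) (ContinuousLinearMap.inr ℝ R K) 0 :=
      (ContinuousLinearMap.inr ℝ R K).hasFDerivAt
    refine (HasFDerivAt.comp (0 : K) (f := fun t : K => ((0 : R), t)) hsd h1).congr_fderiv ?_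
    ext t
    have h2 : eq (t : E) = (0, t) := by
      have h3 : eq (t : E) = (P (f'a t), A t) := rfl
      rw [h3, (hK t).1 t.2, map_zero]
      exact congrArg (Prod.mk 0) (hA t)
    simp [← h2]
  -- `P` loses no information on derivatives near `a`: since `g` stays immersive, `A` embeds the
  -- kernel of `P ∘ f'(x)` into `K`, and the rank hypothesis then forces this kernel to equal that
  -- of `f'(x)`.
  · have hEv : ∀ᶠ x in 𝓝 a, ∀ w, P (fderiv ℝ f x w) = 0 → fderiv ℝ f x w = 0 := by
      filter_upwards [hrank, hf, e.open_source.mem_nhds hae] with x hx hfx hxs w hw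
      have hfd := hfx.differentiableAt (by simp)
      have hi : Function.Injective ((P ∘L fderiv ℝ f x).prod A) := by
        have h1 := (hsm (e x) (e.map_source hxs)).differentiableAt (by simp) |>.hasFDerivAt
        have h2 : HasFDerivAt e ((P ∘L fderiv ℝ f x).prod A) x := by
          have : (e : E → R × K) = g := funext he
          rw [this]; exact hgd x hfd
        have h3 := h1.comp x h2
        have h4 : HasFDerivAt (e.symm ∘ e) (ContinuousLinearMap.id ℝ E) x := by
          refine (hasFDerivAt_id x).congr_of_eventuallyEq ?_
          filter_upwards [e.open_source.mem_nhds hxs] with z hz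
          exact e.left_inv hz
        have h5 := h3.unique h4
        intro u v huv
        have := congrArg (fderiv ℝ e.symm (e x)) huv
        rwa [← ContinuousLinearMap.comp_apply, ← ContinuousLinearMap.comp_apply, h5] at this
      have hle : LinearMap.ker (fderiv ℝ f x).toLinearMap ≤
          LinearMap.ker (P ∘L fderiv ℝ f x).toLinearMap := by
        intro u hu
        have : fderiv ℝ f x u = 0 := hu
        change P (fderiv ℝ f x u) = 0
        rw [this, map_zero]
      have hfin : Module.finrank ℝ (LinearMap.ker (P ∘L fderiv ℝ f x).toLinearMap) ≤
          Module.finrank ℝ K := by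
        refine LinearMap.finrank_le_finrank_of_injective
          (f := A.toLinearMap ∘ₗ (LinearMap.ker (P ∘L fderiv ℝ f x).toLinearMap).subtype) ?_
        intro u v huv
        refine Subtype.ext (hi (Prod.ext ?_ huv))
        have hu : P (fderiv ℝ f x u) = 0 := u.2
        have hv : P (fderiv ℝ f x v) = 0 := v.2
        exact hu.trans hv.symm
      have := Submodule.eq_of_le_of_finrank_le hle (hfin.trans hx)
      have hw' : w ∈ LinearMap.ker (fderiv ℝ f x).toLinearMap := by rw [this]; exact hw
      exact hw'
    -- Along `κ` the function `P (f - f a)` is zero, hence so is its derivative; by `hEv` the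
    -- derivative of `f ∘ κ` itself vanishes.
    have hψ := eventually_eq_of_fderiv_eq_zero (f := fun t => f (κ t)) (a := 0)
      (by
        filter_upwards [hκs, hκc.eventually (by rw [hκ0]; exact hf)] with t h1 h2
        exact (h2.differentiableAt (by simp)).comp t (h1.differentiableAt (by simp)))
      (by
        have hP0 : ∀ᶠ t in 𝓝 (0 : K), (fun t => P (f (κ t) - f a)) =ᶠ[𝓝 t] fun _ => 0 := by
          filter_upwards [eventually_eventually_nhds.2 hgκ] with t ht
          filter_upwards [ht] with s hs
          exact congrArg Prod.fst hs
        filter_upwards [hκs, hκc.eventually (by rw [hκ0]; exact hf), hκc.eventually (by rw [hκ0]; exact hEv), hP0]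
          with t h1 h2 h3 h4
        have hκd := (h1.differentiableAt (by simp)).hasFDerivAt
        have hfd := HasFDerivAt.comp t (h2.differentiableAt (by simp)).hasFDerivAt hκd
        have hPd := P.hasFDerivAt.comp t (hfd.sub_const (f a))
        have h5 := hPd.unique ((hasFDerivAt_const (0 : R) t).congr_of_eventuallyEq h4)
        rw [HasFDerivAt.fderiv (f := fun t => f (κ t)) hfd]
        ext w
        exact h3 _ (DFunLike.congr_fun h5 w))
    simpa [hκ0] using hψ
  · filter_upwards [hgκ] with t ht
    exact congrArg Prod.snd ht
  · filter_upwards [e.open_source.mem_nhds hae] with x hx hfx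
    have : g x = (0, A (x - a)) := by simp [hg, hfx]
    rw [hκ]
    change e.symm (0, A (x - a)) = x
    rw [← this, ← he, e.left_inv hx]

end Analysis
end QuasiPoisson

/-! ### Sections, retractions and fibre charts on manifolds. -/

namespace QuasiPoisson
section ManifoldAnalysis

set_option linter.unusedSectionVars false

variable {E : Type*} [NormedAddCommGroup E] [NormedSpace ℝ E]
  {M : Type*} [TopologicalSpace M] [ChartedSpace E M] [IsManifold 𝓘(ℝ, E) ∞ M]
  {F : Type*} [NormedAddCommGroup F] [NormedSpace ℝ F]
  {N : Type*} [TopologicalSpace N] [ChartedSpace F N] [IsManifold 𝓘(ℝ, F) ∞ N]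

/-- A pair of mutually inverse local diffeomorphisms between `E` near `0` and `M` near `x`, with
derivative the identity in the coordinates of `T_x M`. -/
structure CenteredChart (x : M) where
  param : E → M
  coord : M → E
  param_zero : param 0 = x
  coord_self : coord x = 0
  param_smooth : ∀ᶠ t in 𝓝 0, ContMDiffAt 𝓘(ℝ, E) 𝓘(ℝ, E) ∞ param t
  coord_smooth : ∀ᶠ z in 𝓝 x, ContMDiffAt 𝓘(ℝ, E) 𝓘(ℝ, E) ∞ coord z
  coord_param : ∀ᶠ t in 𝓝 0, coord (param t) = t
  param_coord : ∀ᶠ z in 𝓝 x, param (coord z) = z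
  param_deriv : HasMFDerivAt 𝓘(ℝ, E) 𝓘(ℝ, E) param 0 (ContinuousLinearMap.id ℝ E)
  coord_deriv : HasMFDerivAt 𝓘(ℝ, E) 𝓘(ℝ, E) coord x (ContinuousLinearMap.id ℝ E)

/-- The preferred chart at `x`, translated to send `x` to `0`. Tangent vectors at `x` are by
definition expressed in that chart, which is why both derivatives are the identity. -/
theorem nonempty_centeredChart (x : M) : Nonempty (CenteredChart (E := E) x) := by
  set e := chartAt E x with he
  have hx : x ∈ e.source := mem_chart_source E x
  have hadd : ContMDiff 𝓘(ℝ, E) 𝓘(ℝ, E) ∞ (fun t : E => t + e x) :=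
    (contDiff_id.add contDiff_const).contMDiff
  have hsub : ContMDiff 𝓘(ℝ, E) 𝓘(ℝ, E) ∞ (fun t : E => t - e x) :=
    (contDiff_id.sub contDiff_const).contMDiff
  have hmem : ∀ᶠ t in 𝓝 (0 : E), t + e x ∈ e.target := by
    have : ContinuousAt (fun t : E => t + e x) 0 := by fun_prop
    exact this (e.open_target.mem_nhds (by simpa using e.map_source hx))
  have hps : ∀ᶠ t in 𝓝 (0 : E), ContMDiffAt 𝓘(ℝ, E) 𝓘(ℝ, E) ∞ (fun t => e.symm (t + e x)) t := by
    filter_upwards [hmem] with t ht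
    exact ((contMDiffOn_chart_symm (I := 𝓘(ℝ, E)) (n := ∞) (x := x)).contMDiffAt
      (e.open_target.mem_nhds ht)).comp t hadd.contMDiffAt
  have hcs : ∀ᶠ z in 𝓝 x, ContMDiffAt 𝓘(ℝ, E) 𝓘(ℝ, E) ∞ (fun z => e z - e x) z := by
    filter_upwards [e.open_source.mem_nhds hx] with z hz
    exact hsub.contMDiffAt.comp z ((contMDiffOn_chart (I := 𝓘(ℝ, E)) (n := ∞) (x := x)).contMDiffAt
      (e.open_source.mem_nhds hz))
  refine ⟨⟨fun t => e.symm (t + e x), fun z => e z - e x, ?_, ?_, hps, hcs, ?_, ?_, ?_, ?_⟩⟩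
  · simp [e.left_inv hx]
  · simp
  · filter_upwards [hmem] with t ht
    simp [e.right_inv ht]
  · filter_upwards [e.open_source.mem_nhds hx] with z hz
    simp [e.left_inv hz]
  · refine ⟨hps.self_of_nhds.continuousAt, ?_⟩
    simp only [mfld_simps]
    refine HasFDerivAt.hasFDerivWithinAt (x := (0 : E))
      (((hasFDerivAt_id (𝕜 := ℝ) (0 : E)).add_const (e x)).congr_of_eventuallyEq ?_)
    filter_upwards [hmem] with t ht
    simp only [writtenInExtChartAt, mfld_simps, zero_add, e.left_inv hx, ← he]
    exact e.right_inv ht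
  · refine ⟨hcs.self_of_nhds.continuousAt, ?_⟩
    simp only [mfld_simps]
    refine HasFDerivAt.hasFDerivWithinAt (x := e x)
      (((hasFDerivAt_id (𝕜 := ℝ) (e x)).sub_const (e x)).congr_of_eventuallyEq ?_)
    filter_upwards [e.open_target.mem_nhds (e.map_source hx)] with t ht
    simp only [writtenInExtChartAt, mfld_simps, ← he, e.right_inv ht]
    rfl

theorem CenteredChart.continuousAt_param {x : M} (c : CenteredChart (E := E) x) :
    ContinuousAt c.param 0 := c.param_smooth.self_of_nhds.continuousAt

theorem CenteredChart.continuousAt_coord {x : M} (c : CenteredChart (E := E) x) :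
    ContinuousAt c.coord x := c.coord_smooth.self_of_nhds.continuousAt

theorem CenteredChart.tendsto_param {x : M} (c : CenteredChart (E := E) x) :
    Filter.Tendsto c.param (𝓝 0) (𝓝 x) := by
  simpa only [c.param_zero] using c.continuousAt_param.tendsto

theorem CenteredChart.tendsto_coord {x : M} (c : CenteredChart (E := E) x) :
    Filter.Tendsto c.coord (𝓝 x) (𝓝 0) := by
  simpa only [c.coord_self] using c.continuousAt_coord.tendsto

/-- The expression of `f` in centered charts. -/
def coordExpr {x : M} {y : N} (c : CenteredChart (E := E) x) (d : CenteredChart (E := F) y)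
    (f : M → N) : E → F := fun t => d.coord (f (c.param t))

section

variable {x : M} (c : CenteredChart (E := E) x) {f : M → N} (d : CenteredChart (E := F) (f x))

theorem coordExpr_zero : coordExpr c d f 0 = 0 := by
  simp [coordExpr, c.param_zero, d.coord_self]

theorem coordExpr_contDiffAt (hf : ∀ᶠ z in 𝓝 x, ContMDiffAt 𝓘(ℝ, E) 𝓘(ℝ, F) ∞ f z) :
    ∀ᶠ t in 𝓝 0, ContDiffAt ℝ ∞ (coordExpr c d f) t := by
  have hfc : Filter.Tendsto f (𝓝 x) (𝓝 (f x)) := hf.self_of_nhds.continuousAt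
  filter_upwards [c.param_smooth, c.tendsto_param.eventually hf,
    (hfc.comp c.tendsto_param).eventually d.coord_smooth] with t h1 h2 h3
  rw [← contMDiffAt_iff_contDiffAt]
  exact ContMDiffAt.comp t h3 (ContMDiffAt.comp t h2 h1)

theorem coordExpr_hasFDerivAt {f' : E →L[ℝ] F} (hf : HasMFDerivAt 𝓘(ℝ, E) 𝓘(ℝ, F) f x f') :
    HasFDerivAt (coordExpr c d f) f' 0 := by
  refine hasMFDerivAt_iff_hasFDerivAt.1 ?_
  -- Replacing `x` by the value of the parametrization at `0` makes the base points in the chain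
  -- rule agree definitionally.
  obtain ⟨γ, φ, h0, hφ, h1, h2, h3, h4, h5, h6⟩ := c
  subst h0
  exact HasMFDerivAt.comp (0 : E) d.coord_deriv (HasMFDerivAt.comp (0 : E) hf h5)

end

variable [FiniteDimensional ℝ E] [FiniteDimensional ℝ F]

/-- A submersion has smooth local sections. -/
theorem exists_smooth_local_section {f : M → N} (x : M)
    (hf : ∀ᶠ z in 𝓝 x, ContMDiffAt 𝓘(ℝ, E) 𝓘(ℝ, F) ∞ f z)
    (hsurj : Function.Surjective (mfderiv 𝓘(ℝ, E) 𝓘(ℝ, F) f x)) :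
    ∃ s : N → M, s (f x) = x ∧ ContMDiffAt 𝓘(ℝ, F) 𝓘(ℝ, E) ∞ s (f x) ∧
      ∀ᶠ y in 𝓝 (f x), f (s y) = y := by
  obtain ⟨c⟩ := nonempty_centeredChart (E := E) x
  obtain ⟨d⟩ := nonempty_centeredChart (E := F) (f x)
  set f' : E →L[ℝ] F := mfderiv 𝓘(ℝ, E) 𝓘(ℝ, F) f x with hf'
  have hmd : HasMFDerivAt 𝓘(ℝ, E) 𝓘(ℝ, F) f x f' :=
    (hf.self_of_nhds.mdifferentiableAt (by simp)).hasMFDerivAt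
  obtain ⟨s, hs0, hs, hfs⟩ := exists_local_section (coordExpr_contDiffAt c d hf)
    (coordExpr_hasFDerivAt c d hmd) hsurj
  rw [coordExpr_zero] at hs0 hs hfs
  have hs0' : Filter.Tendsto s (𝓝 0) (𝓝 0) := by
    simpa only [hs0] using hs.self_of_nhds.continuousAt.tendsto
  have hs1 : ContMDiffAt 𝓘(ℝ, F) 𝓘(ℝ, E) ∞ s (d.coord (f x)) := by
    rw [d.coord_self]; exact hs.self_of_nhds.contMDiffAt
  have hc1 : ContMDiffAt 𝓘(ℝ, E) 𝓘(ℝ, E) ∞ c.param (s (d.coord (f x))) := by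
    rw [d.coord_self, hs0]; exact c.param_smooth.self_of_nhds
  have hcs : ContMDiffAt 𝓘(ℝ, F) 𝓘(ℝ, E) ∞ (fun y => c.param (s (d.coord y))) (f x) :=
    ContMDiffAt.comp (f x) hc1 (ContMDiffAt.comp (f x) hs1 d.coord_smooth.self_of_nhds)
  have h0 : c.param (s (d.coord (f x))) = x := by rw [d.coord_self, hs0, c.param_zero]
  refine ⟨fun y => c.param (s (d.coord y)), h0, hcs, ?_⟩
  have hfc : Filter.Tendsto f (𝓝 x) (𝓝 (f x)) := hf.self_of_nhds.continuousAt
  have hT : Filter.Tendsto (fun y => f (c.param (s (d.coord y)))) (𝓝 (f x)) (𝓝 (f x)) :=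
    hfc.comp (c.tendsto_param.comp (hs0'.comp d.tendsto_coord))
  filter_upwards [d.tendsto_coord.eventually hfs, d.param_coord, hT.eventually d.param_coord]
    with y h1 h2 h3
  change d.coord (f (c.param (s (d.coord y)))) = d.coord y at h1
  rw [← h3, h1, h2]

/-- An immersion has smooth local retractions. -/
theorem exists_smooth_local_retraction {f : M → N} (x : M)
    (hf : ∀ᶠ z in 𝓝 x, ContMDiffAt 𝓘(ℝ, E) 𝓘(ℝ, F) ∞ f z)
    (hinj : Function.Injective (mfderiv 𝓘(ℝ, E) 𝓘(ℝ, F) f x)) :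
    ∃ r : N → M, (∀ᶠ y in 𝓝 (f x), ContMDiffAt 𝓘(ℝ, F) 𝓘(ℝ, E) ∞ r y) ∧
      ∀ᶠ z in 𝓝 x, r (f z) = z := by
  obtain ⟨c⟩ := nonempty_centeredChart (E := E) x
  obtain ⟨d⟩ := nonempty_centeredChart (E := F) (f x)
  set f' : E →L[ℝ] F := mfderiv 𝓘(ℝ, E) 𝓘(ℝ, F) f x with hf'
  have hmd : HasMFDerivAt 𝓘(ℝ, E) 𝓘(ℝ, F) f x f' :=
    (hf.self_of_nhds.mdifferentiableAt (by simp)).hasMFDerivAt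
  obtain ⟨r, hr, hrf⟩ := exists_local_retraction (coordExpr_contDiffAt c d hf)
    (coordExpr_hasFDerivAt c d hmd) hinj
  rw [coordExpr_zero] at hr
  have hr0 : r 0 = 0 := by
    have := hrf.self_of_nhds
    rwa [coordExpr_zero] at this
  have hr0' : Filter.Tendsto r (𝓝 0) (𝓝 0) := by
    simpa only [hr0] using hr.self_of_nhds.continuousAt.tendsto
  refine ⟨fun y => c.param (r (d.coord y)), ?_, ?_⟩
  · filter_upwards [d.coord_smooth, d.tendsto_coord.eventually hr,
      (hr0'.comp d.tendsto_coord).eventually c.param_smooth] with y h1 h2 h3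
    exact ContMDiffAt.comp y (g := c.param) h3 (ContMDiffAt.comp y h2.contMDiffAt h1)
  · filter_upwards [c.tendsto_coord.eventually hrf, c.param_coord] with z h1 h2
    change r (d.coord (f (c.param (c.coord z)))) = c.coord z at h1
    rw [h2] at h1
    change c.param (r (d.coord (f z))) = z
    rw [h1, h2]

/-- The map `φ` embeds the kernel of `T` into that of `T'`. -/
theorem finrank_ker_le_of_eq_comp {T T' : E →L[ℝ] F} {φ γ : E →L[ℝ] E} {d : F →L[ℝ] F}
    (h : T' = d ∘L T ∘L γ) (hγφ : ∀ w, γ (φ w) = w) :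
    Module.finrank ℝ (LinearMap.ker T.toLinearMap) ≤
      Module.finrank ℝ (LinearMap.ker T'.toLinearMap) := by
  refine LinearMap.finrank_le_finrank_of_injective
    (f := LinearMap.codRestrict (LinearMap.ker T'.toLinearMap)
      (φ.toLinearMap ∘ₗ (LinearMap.ker T.toLinearMap).subtype) ?_) ?_
  · intro w
    have hw : T w = 0 := w.2
    change T' (φ w) = 0
    simp [h, hγφ, hw]
  · intro u v huv
    have h' : φ u = φ v := congrArg Subtype.val huv
    refine Subtype.ext ?_
    rw [← hγφ u, ← hγφ v, h']

/-- By rank-nullity a surjective map has the smallest kernel. -/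
theorem finrank_le_finrank_ker_of_surjective {T T' : E →L[ℝ] F} {K : Submodule ℝ E}
    (hK : ∀ w, w ∈ K ↔ T w = 0) (hT : Function.Surjective T) :
    Module.finrank ℝ K ≤ Module.finrank ℝ (LinearMap.ker T'.toLinearMap) := by
  have hKer : LinearMap.ker T.toLinearMap = K := by
    ext w; exact (hK w).symm
  have h1 := LinearMap.finrank_range_add_finrank_ker T.toLinearMap
  have h2 := LinearMap.finrank_range_add_finrank_ker T'.toLinearMap
  have h3 := Submodule.finrank_le (LinearMap.range T'.toLinearMap)
  rw [LinearMap.range_eq_top.2 hT, finrank_top, hKer] at h1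
  omega

/-- Carries the rank hypothesis from the manifold to coordinates. The derivative of the chart
supplies a right inverse to that of the parametrization, which is all that
`finrank_ker_le_of_eq_comp` needs. -/
theorem finrank_ker_le_coordExpr {f : M → N} (x : M) (hf : ContMDiff 𝓘(ℝ, E) 𝓘(ℝ, F) ∞ f)
    (c : CenteredChart (E := E) x) (d : CenteredChart (E := F) (f x)) :
    ∀ᶠ t in 𝓝 0,
      Module.finrank ℝ (LinearMap.ker (mfderiv 𝓘(ℝ, E) 𝓘(ℝ, F) f (c.param t)).toLinearMap) ≤
      Module.finrank ℝ (LinearMap.ker (fderiv ℝ (coordExpr c d f) t).toLinearMap) := by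
  have hfc : Filter.Tendsto f (𝓝 x) (𝓝 (f x)) := hf.continuous.continuousAt
  filter_upwards [c.param_smooth, c.coord_param, c.tendsto_param.eventually c.coord_smooth,
    c.tendsto_param.eventually (eventually_eventually_nhds.2 c.param_coord),
    (hfc.comp c.tendsto_param).eventually d.coord_smooth] with t h1 h2 h3 h4 h5
  set z := c.param t with hz
  obtain ⟨γ', hγ⟩ : ∃ γ' : E →L[ℝ] E, HasMFDerivAt 𝓘(ℝ, E) 𝓘(ℝ, E) c.param t γ' :=
    ⟨_, (h1.mdifferentiableAt (by simp)).hasMFDerivAt⟩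
  obtain ⟨φ', hφ⟩ : ∃ φ' : E →L[ℝ] E, HasMFDerivAt 𝓘(ℝ, E) 𝓘(ℝ, E) c.coord z φ' :=
    ⟨_, (h3.mdifferentiableAt (by simp)).hasMFDerivAt⟩
  obtain ⟨d', hd⟩ : ∃ d' : F →L[ℝ] F, HasMFDerivAt 𝓘(ℝ, F) 𝓘(ℝ, F) d.coord (f z) d' :=
    ⟨_, (h5.mdifferentiableAt (by simp)).hasMFDerivAt⟩
  set T : E →L[ℝ] F := mfderiv 𝓘(ℝ, E) 𝓘(ℝ, F) f z with hT
  have hfd : HasMFDerivAt 𝓘(ℝ, E) 𝓘(ℝ, F) f z T :=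
    ((hf z).mdifferentiableAt (by simp)).hasMFDerivAt
  have hexp : HasMFDerivAt 𝓘(ℝ, E) 𝓘(ℝ, F) (coordExpr c d f) t (d' ∘L T ∘L γ') :=
    HasMFDerivAt.comp t hd (HasMFDerivAt.comp t hfd hγ)
  have hexp' : HasFDerivAt (coordExpr c d f) (d' ∘L T ∘L γ') t :=
    hasMFDerivAt_iff_hasFDerivAt.1 hexp
  have hid : ∀ w : E, γ' (φ' w) = w := by
    have hγ' : HasMFDerivAt 𝓘(ℝ, E) 𝓘(ℝ, E) c.param (c.coord z) γ' := by rw [h2]; exact hγ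
    have hid' := (hasMFDerivAt_id (I := 𝓘(ℝ, E)) z).congr_of_eventuallyEq
      (f₁ := c.param ∘ c.coord) h4
    intro w
    exact DFunLike.congr_fun (hasMFDerivAt_unique (HasMFDerivAt.comp z hγ' hφ) hid') w
  exact finrank_ker_le_of_eq_comp (E := E) (F := F) (T := T) hexp'.fderiv hid

/-- The constant rank theorem on manifolds: the fibre of `f` through `x` is parametrized, near `x`,
by the kernel `K` of the derivative. -/
theorem exists_smooth_fibre_chart {f : M → N} (x : M) (hf : ContMDiff 𝓘(ℝ, E) 𝓘(ℝ, F) ∞ f)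
    (K : Submodule ℝ E)
    (hK : ∀ w : TangentSpace 𝓘(ℝ, E) x, w ∈ K ↔ mfderiv 𝓘(ℝ, E) 𝓘(ℝ, F) f x w = 0)
    (hrank : ∀ᶠ z in 𝓝 x, Module.finrank ℝ K ≤
      Module.finrank ℝ (LinearMap.ker (mfderiv 𝓘(ℝ, E) 𝓘(ℝ, F) f z).toLinearMap)) :
    ∃ (κ : K → M) (A : M → K), κ 0 = x ∧ A x = 0 ∧
      (∀ᶠ t in 𝓝 0, ContMDiffAt 𝓘(ℝ, K) 𝓘(ℝ, E) ∞ κ t) ∧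
      (∀ᶠ z in 𝓝 x, ContMDiffAt 𝓘(ℝ, E) 𝓘(ℝ, K) ∞ A z) ∧
      HasMFDerivAt 𝓘(ℝ, K) 𝓘(ℝ, E) κ 0 K.subtypeL ∧
      (∀ᶠ t in 𝓝 0, f (κ t) = f x) ∧ (∀ᶠ t in 𝓝 0, A (κ t) = t) ∧
      ∀ᶠ z in 𝓝 x, f z = f x → κ (A z) = z := by
  obtain ⟨c⟩ := nonempty_centeredChart (E := E) x
  obtain ⟨d⟩ := nonempty_centeredChart (E := F) (f x)
  have hfe : ∀ᶠ z in 𝓝 x, ContMDiffAt 𝓘(ℝ, E) 𝓘(ℝ, F) ∞ f z := .of_forall fun z => hf z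
  set f' : E →L[ℝ] F := mfderiv 𝓘(ℝ, E) 𝓘(ℝ, F) f x with hf'
  have hmd : HasMFDerivAt 𝓘(ℝ, E) 𝓘(ℝ, F) f x f' :=
    (hfe.self_of_nhds.mdifferentiableAt (by simp)).hasMFDerivAt
  have hfd := coordExpr_hasFDerivAt c d hmd
  obtain ⟨κ, A, hκ0, hκs, hκd, hfκ, hAκ, hκA⟩ := exists_fibre_parametrization
    (f := coordExpr c d f) (a := 0) K (by rw [hfd.fderiv]; exact hK)
    (coordExpr_contDiffAt c d hfe) (by
      filter_upwards [c.tendsto_param.eventually hrank, finrank_ker_le_coordExpr x hf c d]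
        with t h1 h2
      exact h1.trans h2)
  have hκT : Filter.Tendsto κ (𝓝 0) (𝓝 0) := by
    simpa only [hκ0] using hκs.self_of_nhds.continuousAt.tendsto
  have hfc : Filter.Tendsto f (𝓝 x) (𝓝 (f x)) := hf.continuous.continuousAt
  refine ⟨fun t => c.param (κ t), fun z => A (c.coord z), ?_, ?_, ?_, ?_, ?_, ?_, ?_, ?_⟩
  · simp only [hκ0, c.param_zero]
  · simp only [c.coord_self, map_zero]
  · filter_upwards [hκs, hκT.eventually c.param_smooth] with t h1 h2
    exact ContMDiffAt.comp t h2 h1.contMDiffAt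
  · filter_upwards [c.coord_smooth] with z h1
    exact ContMDiffAt.comp z A.contDiff.contMDiff.contMDiffAt h1
  · have h1 : HasMFDerivAt 𝓘(ℝ, K) 𝓘(ℝ, E) κ 0 K.subtypeL := hκd.hasMFDerivAt
    have h2 : HasMFDerivAt 𝓘(ℝ, E) 𝓘(ℝ, E) c.param (κ 0) (ContinuousLinearMap.id ℝ E) := by
      rw [hκ0]; exact c.param_deriv
    exact HasMFDerivAt.comp (0 : K) h2 h1
  · filter_upwards [hfκ, (hfc.comp (c.tendsto_param.comp hκT)).eventually d.param_coord]
      with t h1 h2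
    rw [coordExpr_zero] at h1
    change d.coord (f (c.param (κ t))) = 0 at h1
    change d.param (d.coord (f (c.param (κ t)))) = f (c.param (κ t)) at h2
    rw [← h2, h1, d.param_zero]
  · filter_upwards [hAκ, hκT.eventually c.coord_param] with t h1 h2
    rw [h2]; simpa using h1
  · filter_upwards [c.tendsto_coord.eventually hκA, c.param_coord] with z h1 h2 h3
    have := h1 (by
      rw [coordExpr_zero]
      change d.coord (f (c.param (c.coord z))) = 0
      rw [h2, h3, d.coord_self])
    rw [sub_zero] at this
    rw [this, h2]

/-- A submersion satisfies the rank hypothesis of `exists_smooth_fibre_chart`. -/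
theorem finrank_ker_le_of_surjective {f : M → N} (x z : M) (K : Submodule ℝ E)
    (hK : ∀ w : TangentSpace 𝓘(ℝ, E) x, w ∈ K ↔ mfderiv 𝓘(ℝ, E) 𝓘(ℝ, F) f x w = 0)
    (hsurj : Function.Surjective (mfderiv 𝓘(ℝ, E) 𝓘(ℝ, F) f x)) :
    Module.finrank ℝ K ≤
      Module.finrank ℝ (LinearMap.ker (mfderiv 𝓘(ℝ, E) 𝓘(ℝ, F) f z).toLinearMap) := by
  exact finrank_le_finrank_ker_of_surjective (E := E) (F := F) hK hsurj

end ManifoldAnalysis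
end QuasiPoisson

/-! ### Orbit maps, isotropy and the dressing action. -/

namespace QuasiPoisson
section OrbitMaps

set_option linter.unusedSectionVars false

variable {EG : Type*} [NormedAddCommGroup EG] [NormedSpace ℝ EG] [FiniteDimensional ℝ EG]
  {G : Type*} [TopologicalSpace G] [ChartedSpace EG G] [Group G] [LieGroup 𝓘(ℝ, EG) ∞ G]
  {F : Type*} [NormedAddCommGroup F] [NormedSpace ℝ F] [FiniteDimensional ℝ F]
  {N : Type*} [TopologicalSpace N] [ChartedSpace F N] [IsManifold 𝓘(ℝ, F) ∞ N]

theorem exists_hasMFDerivAt_mul_left (g : G) : ∃ L L' : EG →L[ℝ] EG,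
    HasMFDerivAt 𝓘(ℝ, EG) 𝓘(ℝ, EG) (fun h : G => g * h) 1 L ∧ (∀ w, L' (L w) = w) ∧
      ∀ w, L (L' w) = w := by
  have h1 : HasMFDerivAt 𝓘(ℝ, EG) 𝓘(ℝ, EG) (fun h : G => g * h) 1
      (mfderiv 𝓘(ℝ, EG) 𝓘(ℝ, EG) (fun h : G => g * h) 1) :=
    ((contMDiff_mul_left (I := 𝓘(ℝ, EG)) (n := ∞) (a := g) 1).mdifferentiableAt
      (by simp)).hasMFDerivAt
  have h2 : HasMFDerivAt 𝓘(ℝ, EG) 𝓘(ℝ, EG) (fun h : G => g⁻¹ * h) (g * 1)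
      (mfderiv 𝓘(ℝ, EG) 𝓘(ℝ, EG) (fun h : G => g⁻¹ * h) (g * 1)) :=
    ((contMDiff_mul_left (I := 𝓘(ℝ, EG)) (n := ∞) (a := g⁻¹) (g * 1)).mdifferentiableAt
      (by simp)).hasMFDerivAt
  refine ⟨mfderiv 𝓘(ℝ, EG) 𝓘(ℝ, EG) (fun h : G => g * h) 1,
    mfderiv 𝓘(ℝ, EG) 𝓘(ℝ, EG) (fun h : G => g⁻¹ * h) (g * 1), h1, ?_, ?_⟩
  · have h3 := HasMFDerivAt.comp (1 : G) h2 h1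
    have h4 := (hasMFDerivAt_id (I := 𝓘(ℝ, EG)) (1 : G)).congr_of_eventuallyEq
      (f₁ := (fun h : G => g⁻¹ * h) ∘ fun h => g * h) (.of_forall fun h => by simp)
    intro w
    exact DFunLike.congr_fun (hasMFDerivAt_unique h3 h4) w
  · have h1' : HasMFDerivAt 𝓘(ℝ, EG) 𝓘(ℝ, EG) (fun h : G => g * h) (g⁻¹ * (g * 1))
      (mfderiv 𝓘(ℝ, EG) 𝓘(ℝ, EG) (fun h : G => g * h) 1) := by
      rw [inv_mul_cancel_left]; exact h1
    have h3 := HasMFDerivAt.comp (g * 1 : G) h1' h2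
    have h4 := (hasMFDerivAt_id (I := 𝓘(ℝ, EG)) (g * 1 : G)).congr_of_eventuallyEq
      (f₁ := (fun h : G => g * h) ∘ fun h => g⁻¹ * h) (.of_forall fun h => by simp)
    intro w
    exact DFunLike.congr_fun (hasMFDerivAt_unique h3 h4) w

/-- Equivariant maps have constant rank: `L` is the derivative of a left translation, `S` that of
the action on the target, and `L` embeds the kernel at `1` into the kernel at `g`. -/
theorem finrank_ker_le_of_injective_comp {T T' : EG →L[ℝ] F} {L L' : EG →L[ℝ] EG} {S : F →L[ℝ] F}
    {K : Submodule ℝ EG} (hK : ∀ w, w ∈ K ↔ T w = 0)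
    (h : T' ∘L L = S ∘L T) (hL : ∀ w, L' (L w) = w) :
    Module.finrank ℝ K ≤ Module.finrank ℝ (LinearMap.ker T'.toLinearMap) := by
  refine LinearMap.finrank_le_finrank_of_injective
    (f := LinearMap.codRestrict (LinearMap.ker T'.toLinearMap)
      (L.toLinearMap ∘ₗ K.subtype) ?_) ?_
  · intro w
    have hw : T w = 0 := (hK w).1 w.2
    have := DFunLike.congr_fun h (w : EG)
    change T' (L w) = 0
    change T' (L w) = S (T w) at this
    rw [this, hw, map_zero]
  · intro u v huv
    have h' : L u = L v := congrArg Subtype.val huv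
    refine Subtype.ext ?_
    rw [← hL u, ← hL v, h']

/-- The isotropy subgroup of an orbit map is parametrized, near `1`, by the kernel of the
derivative. -/
theorem exists_isotropy_chart {β : G → N} (hβ : ContMDiff 𝓘(ℝ, EG) 𝓘(ℝ, F) ∞ β)
    (act : G → N → N) (hact : ∀ g, ContMDiff 𝓘(ℝ, F) 𝓘(ℝ, F) ∞ (act g))
    (hmul : ∀ g h, β (g * h) = act g (β h)) (K : Submodule ℝ EG)
    (hK : ∀ w : TangentSpace 𝓘(ℝ, EG) (1 : G), w ∈ K ↔ mfderiv 𝓘(ℝ, EG) 𝓘(ℝ, F) β 1 w = 0) :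
    ∃ κ : K → G, κ 0 = 1 ∧ (∀ᶠ t in 𝓝 0, ContMDiffAt 𝓘(ℝ, K) 𝓘(ℝ, EG) ∞ κ t) ∧
      HasMFDerivAt 𝓘(ℝ, K) 𝓘(ℝ, EG) κ 0 K.subtypeL ∧ ∀ᶠ t in 𝓝 0, β (κ t) = β 1 := by
  obtain ⟨κ, A, h0, -, hs, -, hd, hf, -⟩ := exists_smooth_fibre_chart (1 : G) hβ K hK
    (.of_forall fun g => by
      obtain ⟨L, L', hL, hL', -⟩ := exists_hasMFDerivAt_mul_left (EG := EG) g
      have hβ1 : HasMFDerivAt 𝓘(ℝ, EG) 𝓘(ℝ, F) β 1 (mfderiv 𝓘(ℝ, EG) 𝓘(ℝ, F) β 1) :=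
        ((hβ 1).mdifferentiableAt (by simp)).hasMFDerivAt
      have hβg : HasMFDerivAt 𝓘(ℝ, EG) 𝓘(ℝ, F) β (g * 1) (mfderiv 𝓘(ℝ, EG) 𝓘(ℝ, F) β g) := by
        rw [mul_one]
        exact ((hβ g).mdifferentiableAt (by simp)).hasMFDerivAt
      have ha : HasMFDerivAt 𝓘(ℝ, F) 𝓘(ℝ, F) (act g) (β 1)
          (mfderiv 𝓘(ℝ, F) 𝓘(ℝ, F) (act g) (β 1)) :=
        ((hact g (β 1)).mdifferentiableAt (by simp)).hasMFDerivAt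
      have h1 := HasMFDerivAt.comp (1 : G) hβg hL
      have h2 := (HasMFDerivAt.comp (1 : G) ha hβ1).congr_of_eventuallyEq
        (f₁ := β ∘ fun h => g * h) (.of_forall fun h => hmul g h)
      exact finrank_ker_le_of_injective_comp (EG := EG) (F := F)
        (S := mfderiv 𝓘(ℝ, F) 𝓘(ℝ, F) (act g) (β 1)) hK (hasMFDerivAt_unique h1 h2) hL')
  exact ⟨κ, h0, hs, hd, hf⟩

/-- An orbit map with trivial isotropy is an immersion. -/
theorem injective_mfderiv_of_injective {β : G → N} (hβ : ContMDiff 𝓘(ℝ, EG) 𝓘(ℝ, F) ∞ β)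
    (act : G → N → N) (hact : ∀ g, ContMDiff 𝓘(ℝ, F) 𝓘(ℝ, F) ∞ (act g))
    (hmul : ∀ g h, β (g * h) = act g (β h)) (hinj : ∀ g, β g = β 1 → g = 1) :
    ∀ w : TangentSpace 𝓘(ℝ, EG) (1 : G), mfderiv 𝓘(ℝ, EG) 𝓘(ℝ, F) β 1 w = 0 → w = 0 := by
  set T : EG →L[ℝ] F := mfderiv 𝓘(ℝ, EG) 𝓘(ℝ, F) β 1 with hT
  obtain ⟨κ, h0, hs, hd, hf⟩ := exists_isotropy_chart hβ act hact hmul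
    (LinearMap.ker T.toLinearMap) (fun w => Iff.rfl)
  -- The chart `κ` of the isotropy group is constantly `1`, yet its derivative is the inclusion of
  -- the kernel; so the kernel is zero.
  have hc := (hasMFDerivAt_const (I := 𝓘(ℝ, LinearMap.ker T.toLinearMap)) (I' := 𝓘(ℝ, EG))
    (1 : G) (0 : LinearMap.ker T.toLinearMap)).congr_of_eventuallyEq (f₁ := κ)
    (hf.mono fun t ht => hinj _ ht)
  intro w hw
  exact DFunLike.congr_fun (hasMFDerivAt_unique hd hc) (⟨w, hw⟩ : LinearMap.ker T.toLinearMap)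

end OrbitMaps

section Dressing

variable {ED : Type*} [NormedAddCommGroup ED] [NormedSpace ℝ ED] [FiniteDimensional ℝ ED]
  {D : Type*} [TopologicalSpace D] [ChartedSpace ED D] [Group D] [LieGroup 𝓘(ℝ, ED) ∞ D]
  {EG : Type*} [NormedAddCommGroup EG] [NormedSpace ℝ EG]
  {G : Type*} [TopologicalSpace G] [ChartedSpace EG G] [Group G]
  (P : SplitManinPair ED D EG G)
  {ES : Type*} [NormedAddCommGroup ES] [NormedSpace ℝ ES] [FiniteDimensional ℝ ES]
  [ChartedSpace ES P.S] [IsManifold 𝓘(ℝ, ES) ∞ P.S]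

/-- `D` acts on `S = D / G` by smooth maps. -/
theorem contMDiff_dressing
    (hS_smooth : ContMDiff 𝓘(ℝ, ED) 𝓘(ℝ, ES) ∞ (fun a : D => (a : P.S)))
    (hS_submersion : ∀ a : D,
      Function.Surjective (mfderiv 𝓘(ℝ, ED) 𝓘(ℝ, ES) (fun a : D => (a : P.S)) a)) (a : D) :
    ContMDiff 𝓘(ℝ, ES) 𝓘(ℝ, ES) ∞ (fun s : P.S => a • s) := by
  intro s
  obtain ⟨b, rfl⟩ := QuotientGroup.mk_surjective s
  obtain ⟨σ, h0, hσ, hqσ⟩ := exists_smooth_local_section b (.of_forall fun z => hS_smooth z)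
    (hS_submersion b)
  -- Through a local section `σ` of `D → S`, the action becomes left multiplication in `D` followed
  -- by the projection.
  have h1 : ContMDiffAt 𝓘(ℝ, ES) 𝓘(ℝ, ES) ∞ (fun s : P.S => ((a * σ s : D) : P.S)) (b : P.S) :=
    ContMDiffAt.comp (b : P.S) (g := fun a : D => (a : P.S)) (f := fun s => a * σ s)
      hS_smooth.contMDiffAt (ContMDiffAt.comp (b : P.S) (g := fun c : D => a * c)
        contMDiff_mul_left.contMDiffAt hσ)
  refine h1.congr_of_eventuallyEq ?_
  filter_upwards [hqσ] with s hs
  change a • s = a • ((σ s : D) : P.S)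
  rw [hs]

theorem contMDiff_dressing_orbit
    (hS_smooth : ContMDiff 𝓘(ℝ, ED) 𝓘(ℝ, ES) ∞ (fun a : D => (a : P.S))) (y : P.S) :
    ContMDiff 𝓘(ℝ, EG) 𝓘(ℝ, ES) ∞ (fun g : G => P.incl g • y) := by
  obtain ⟨b, rfl⟩ := QuotientGroup.mk_surjective y
  exact hS_smooth.comp (g := fun a : D => (a : P.S)) (f := fun g => P.incl g * b)
    (contMDiff_mul_right.comp P.incl_smooth)

end Dressing
end QuasiPoisson

/-! ### Bracket calculus on M and derivatives along fundamental fields. -/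

namespace QuasiPoisson
section Generic

set_option linter.unusedSectionVars false

variable {EM : Type*} [NormedAddCommGroup EM] [NormedSpace ℝ EM]
  {M : Type*} [TopologicalSpace M] [ChartedSpace EM M]

theorem hasMFDerivAt_mvfderiv {F : M → ℝ} (hF : ContMDiff 𝓘(ℝ, EM) 𝓘(ℝ, ℝ) ∞ F) (x : M) :
    HasMFDerivAt 𝓘(ℝ, EM) 𝓘(ℝ, ℝ) F x (mvfderiv 𝓘(ℝ, EM) F x) :=
  ((hF x).mdifferentiableAt (by simp)).hasMFDerivAt

theorem mdifferentiableAt_of_smooth {F : M → ℝ} (hF : ContMDiff 𝓘(ℝ, EM) 𝓘(ℝ, ℝ) ∞ F) (x : M) :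
    MDifferentiableAt 𝓘(ℝ, EM) 𝓘(ℝ, ℝ) F x := (hF x).mdifferentiableAt (by simp)

namespace BivectorField

variable (π : BivectorField EM M)

theorem bracket_self (F : M → ℝ) (x : M) : π.bracket F F x = 0 := π.skew x _

theorem bracket_smooth {F K : M → ℝ} (hF : ContMDiff 𝓘(ℝ, EM) 𝓘(ℝ, ℝ) ∞ F)
    (hK : ContMDiff 𝓘(ℝ, EM) 𝓘(ℝ, ℝ) ∞ K) : ContMDiff 𝓘(ℝ, EM) 𝓘(ℝ, ℝ) ∞ (π.bracket F K) :=
  π.smooth F K hF hK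

theorem bracket_swap (F K : M → ℝ) (x : M) : π.bracket F K x = - π.bracket K F x := by
  have h := π.skew x (mvfderiv 𝓘(ℝ, EM) F x + mvfderiv 𝓘(ℝ, EM) K x)
  have h1 := π.skew x (mvfderiv 𝓘(ℝ, EM) F x)
  have h2 := π.skew x (mvfderiv 𝓘(ℝ, EM) K x)
  rw [map_add, map_add, ContinuousLinearMap.add_apply, ContinuousLinearMap.add_apply, h1, h2] at h
  unfold bracket
  linarith

theorem bracket_add_right (F : M → ℝ) {K K' : M → ℝ} (hK : ContMDiff 𝓘(ℝ, EM) 𝓘(ℝ, ℝ) ∞ K)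
    (hK' : ContMDiff 𝓘(ℝ, EM) 𝓘(ℝ, ℝ) ∞ K') (x : M) :
    π.bracket F (K + K') x = π.bracket F K x + π.bracket F K' x := by
  unfold bracket
  rw [mvfderiv_add (mdifferentiableAt_of_smooth hK x) (mdifferentiableAt_of_smooth hK' x)]
  rfl

theorem bracket_sub_right (F : M → ℝ) {K K' : M → ℝ} (hK : ContMDiff 𝓘(ℝ, EM) 𝓘(ℝ, ℝ) ∞ K)
    (hK' : ContMDiff 𝓘(ℝ, EM) 𝓘(ℝ, ℝ) ∞ K') (x : M) :
    π.bracket F (K - K') x = π.bracket F K x - π.bracket F K' x := by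
  unfold bracket
  rw [mvfderiv_sub (mdifferentiableAt_of_smooth hK x) (mdifferentiableAt_of_smooth hK' x)]
  rfl

theorem bracket_mul_right (F : M → ℝ) {K K' : M → ℝ} (hK : ContMDiff 𝓘(ℝ, EM) 𝓘(ℝ, ℝ) ∞ K)
    (hK' : ContMDiff 𝓘(ℝ, EM) 𝓘(ℝ, ℝ) ∞ K') (x : M) :
    π.bracket F (K * K') x = π.bracket F K x * K' x + K x * π.bracket F K' x := by
  unfold bracket
  rw [mvfderiv_mul (mdifferentiableAt_of_smooth hK x) (mdifferentiableAt_of_smooth hK' x)]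
  simp
  ring

theorem bracket_const_mul_right (F : M → ℝ) (c : ℝ) {K : M → ℝ}
    (hK : ContMDiff 𝓘(ℝ, EM) 𝓘(ℝ, ℝ) ∞ K) (x : M) :
    π.bracket F (fun z => c * K z) x = c * π.bracket F K x := by
  have h := π.bracket_mul_right F (K := fun _ => c) (K' := K) contMDiff_const hK x
  have h0 : π.bracket F (fun _ => c) x = 0 := by
    unfold bracket
    rw [mvfderiv_const]; rfl
  rw [h0, zero_mul, zero_add] at h
  exact h

end BivectorField

variable {N : Type*} [TopologicalSpace N] {EN : Type*} [NormedAddCommGroup EN] [NormedSpace ℝ EN]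
  [ChartedSpace EN N] [FiniteDimensional ℝ EM] [FiniteDimensional ℝ EN]
  [IsManifold 𝓘(ℝ, EM) ∞ M] [IsManifold 𝓘(ℝ, EN) ∞ N]

theorem exists_factorization {T : EM →L[ℝ] EN} {S : EM →L[ℝ] ℝ} (hT : Function.Surjective T)
    (h : ∀ w, T w = 0 → S w = 0) : ∃ α : EN →L[ℝ] ℝ, S = α ∘L T := by
  obtain ⟨B, hB⟩ := exists_rightInverse_of_surjective hT
  refine ⟨S ∘L B, ?_⟩
  ext w
  have := h (w - B (T w)) (by rw [map_sub, hB, sub_self])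
  rw [map_sub, sub_eq_zero] at this
  exact this

/-- A smooth function which vanishes on the fibre of a submersion has a differential which is
pulled back from the base. -/
theorem exists_mvfderiv_eq_comp {f : M → N} {x : M} (hf : ContMDiff 𝓘(ℝ, EM) 𝓘(ℝ, EN) ∞ f)
    (hsurj : Function.Surjective (mfderiv 𝓘(ℝ, EM) 𝓘(ℝ, EN) f x)) {F : M → ℝ}
    (hF : ContMDiff 𝓘(ℝ, EM) 𝓘(ℝ, ℝ) ∞ F) (hF0 : ∀ᶠ z in 𝓝 x, f z = f x → F z = 0) :
    ∃ α : TangentSpace 𝓘(ℝ, EN) (f x) →L[ℝ] ℝ,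
      mvfderiv 𝓘(ℝ, EM) F x = α ∘L mfderiv 𝓘(ℝ, EM) 𝓘(ℝ, EN) f x := by
  set T : EM →L[ℝ] EN := mfderiv 𝓘(ℝ, EM) 𝓘(ℝ, EN) f x with hT
  refine exists_factorization (EM := EM) (EN := EN) (T := T) hsurj ?_
  intro w hw
  -- Every kernel vector is tangent to the fibre chart `κ`, along which `F` vanishes identically.
  obtain ⟨κ, A, h0, -, hs, -, hd, hfκ, -⟩ := exists_smooth_fibre_chart x hf
    (LinearMap.ker T.toLinearMap) (fun w => Iff.rfl)
    (.of_forall fun z => finrank_ker_le_of_surjective x z _ (fun w => Iff.rfl) hsurj)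
  have hκT : Filter.Tendsto κ (𝓝 0) (𝓝 x) := by
    simpa only [h0] using hs.self_of_nhds.continuousAt.tendsto
  have hF' : HasMFDerivAt 𝓘(ℝ, EM) 𝓘(ℝ, ℝ) F (κ 0) (mvfderiv 𝓘(ℝ, EM) F x) := by
    rw [h0]; exact hasMFDerivAt_mvfderiv hF x
  have h1 := HasMFDerivAt.comp (0 : LinearMap.ker T.toLinearMap) hF' hd
  have h2 := (hasMFDerivAt_const (I := 𝓘(ℝ, LinearMap.ker T.toLinearMap)) (I' := 𝓘(ℝ, ℝ))
    (0 : ℝ) (0 : LinearMap.ker T.toLinearMap)).congr_of_eventuallyEq (f₁ := F ∘ κ) (by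
      filter_upwards [hκT.eventually hF0, hfκ] with t h3 h4
      exact h3 h4)
  exact DFunLike.congr_fun (hasMFDerivAt_unique h1 h2) (⟨w, hw⟩ : LinearMap.ker T.toLinearMap)

variable {EG : Type*} [NormedAddCommGroup EG] [NormedSpace ℝ EG]
  {G : Type*} [TopologicalSpace G] [ChartedSpace EG G] [Group G] [LieGroup 𝓘(ℝ, EG) ∞ G]
  [MulAction G M] [ContMDiffSMul 𝓘(ℝ, EG) 𝓘(ℝ, EM) ∞ G M]

theorem contMDiff_orbit (x : M) : ContMDiff 𝓘(ℝ, EG) 𝓘(ℝ, EM) ∞ (fun a : G => a • x) :=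
  (contMDiff_id (I := 𝓘(ℝ, EG)) (M := G)).smul contMDiff_const

theorem hasMFDerivAt_infAction (x : M) :
    HasMFDerivAt 𝓘(ℝ, EG) 𝓘(ℝ, EM) (fun a : G => a • x) 1 (infAction EG G EM x) :=
  ((contMDiff_orbit (EG := EG) (EM := EM) x 1).mdifferentiableAt (by simp)).hasMFDerivAt

theorem hasMFDerivAt_comp_orbit {F : M → ℝ} (hF : ContMDiff 𝓘(ℝ, EM) 𝓘(ℝ, ℝ) ∞ F) (x : M) :
    HasMFDerivAt 𝓘(ℝ, EG) 𝓘(ℝ, ℝ) (fun a : G => F (a • x)) 1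
      (mvfderiv 𝓘(ℝ, EM) F x ∘L infAction EG G EM x) := by
  have h1 : HasMFDerivAt 𝓘(ℝ, EM) 𝓘(ℝ, ℝ) F ((1 : G) • x) (mvfderiv 𝓘(ℝ, EM) F x) := by
    rw [one_smul]; exact hasMFDerivAt_mvfderiv hF x
  exact HasMFDerivAt.comp (1 : G) h1 (hasMFDerivAt_infAction x)

/-- The function is the derivative at `w = 0` of `F (c.param w • x)`, which is jointly smooth in `x`
and `w`. Smoothness lets it serve as an extension of zero. -/
theorem derivAlong_infAction_smooth {F : M → ℝ} (hF : ContMDiff 𝓘(ℝ, EM) 𝓘(ℝ, ℝ) ∞ F)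
    (v : GroupLieAlgebra 𝓘(ℝ, EG) G) :
    ContMDiff 𝓘(ℝ, EM) 𝓘(ℝ, ℝ) ∞ (derivAlong (fun x => infAction EG G EM x v) F) := by
  intro x₀
  obtain ⟨c⟩ := nonempty_centeredChart (E := EG) (1 : G)
  let f : M → EG → ℝ := fun x w => F (c.param w • x)
  have hf : ContMDiffAt (𝓘(ℝ, EM).prod 𝓘(ℝ, EG)) 𝓘(ℝ, ℝ) ∞ (Function.uncurry f) (x₀, 0) := by
    have h1 : ContMDiffAt (𝓘(ℝ, EM).prod 𝓘(ℝ, EG)) 𝓘(ℝ, EM) ∞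
        (fun p : M × EG => c.param p.2 • p.1) (x₀, 0) :=
      ContMDiffAt.smul (f := fun p : M × EG => c.param p.2) (g := fun p : M × EG => p.1)
        (ContMDiffAt.comp (x₀, (0 : EG)) (g := c.param) c.param_smooth.self_of_nhds
          contMDiffAt_snd) contMDiffAt_fst
    exact hF.contMDiffAt.comp _ h1
  have h1 := ContMDiffAt.mfderiv (m := ∞) f (fun _ => (0 : EG)) hf contMDiffAt_const (by simp)
  have h1' : ContMDiffAt 𝓘(ℝ, EM) 𝓘(ℝ, EG →L[ℝ] ℝ) ∞
      (fun x => (mfderiv 𝓘(ℝ, EG) 𝓘(ℝ, ℝ) (f x) 0 : EG →L[ℝ] ℝ)) x₀ :=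
    h1.congr_of_eventuallyEq (.of_forall fun x => (congrFun (inTangentCoordinates_model_space
      (I := 𝓘(ℝ, EG)) (I' := 𝓘(ℝ, ℝ)) (fun _ : M => (0 : EG)) (fun x => f x 0)
      (fun x => (mfderiv 𝓘(ℝ, EG) 𝓘(ℝ, ℝ) (f x) 0 : EG →L[ℝ] ℝ)) x₀) x).symm)
  have h2 := h1'.clm_apply (contMDiffAt_const (I' := 𝓘(ℝ, EG)) (M' := EG) (c := v))
  refine h2.congr_of_eventuallyEq (.of_forall fun x => ?_)
  have h3 : HasMFDerivAt 𝓘(ℝ, EG) 𝓘(ℝ, ℝ) (fun a : G => F (a • x)) (c.param 0)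
      (mvfderiv 𝓘(ℝ, EM) F x ∘L infAction EG G EM x) := by
    rw [c.param_zero]; exact hasMFDerivAt_comp_orbit hF x
  have h4 := (HasMFDerivAt.comp (0 : EG) h3 c.param_deriv).mfderiv
  exact (DFunLike.congr_fun h4 v).symm

end Generic

theorem contMDiff_translation {EM : Type*} [NormedAddCommGroup EM] [NormedSpace ℝ EM]
    {M : Type*} [TopologicalSpace M] [ChartedSpace EM M]
    (EG : Type*) [NormedAddCommGroup EG] [NormedSpace ℝ EG]
    {G : Type*} [TopologicalSpace G] [ChartedSpace EG G] [Group G]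
    [MulAction G M] [ContMDiffSMul 𝓘(ℝ, EG) 𝓘(ℝ, EM) ∞ G M] (a : G) :
    ContMDiff 𝓘(ℝ, EM) 𝓘(ℝ, EM) ∞ (fun x : M => a • x) :=
  (contMDiff_const (I' := 𝓘(ℝ, EG)) (c := a)).smul contMDiff_id
end QuasiPoisson

/-! ### The topology of J⁻¹(𝒪) and regularity of its points. -/

namespace QuasiPoisson
namespace SplitManinPair

variable {ED : Type*} [NormedAddCommGroup ED] [NormedSpace ℝ ED]
  {D : Type*} [TopologicalSpace D] [ChartedSpace ED D] [Group D]
  {EG : Type*} [NormedAddCommGroup EG] [NormedSpace ℝ EG]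
  {G : Type*} [TopologicalSpace G] [ChartedSpace EG G] [Group G]
  (P : SplitManinPair ED D EG G)

/-- The orbit map `G → 𝒪`. -/
def orbitPoint (y : P.S) (g : G) : P.DressingOrbit y := ⟨P.incl g • y, g, rfl⟩

theorem continuous_orbitPoint (y : P.S) : Continuous (P.orbitPoint y) :=
  continuous_iff_coinduced_le.2 le_rfl

theorem isOpen_dressingOrbit_iff {y : P.S} {U : Set (P.DressingOrbit y)} :
    IsOpen U ↔ IsOpen (P.orbitPoint y ⁻¹' U) :=
  isOpen_coinduced

end SplitManinPair

namespace HamiltonianSpace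
section Topology

set_option linter.unusedSectionVars false

variable {ED : Type*} [NormedAddCommGroup ED] [NormedSpace ℝ ED]
  {D : Type*} [TopologicalSpace D] [ChartedSpace ED D] [Group D]
  {EG : Type*} [NormedAddCommGroup EG] [NormedSpace ℝ EG] [FiniteDimensional ℝ EG]
  {G : Type*} [TopologicalSpace G] [ChartedSpace EG G] [Group G] [LieGroup 𝓘(ℝ, EG) ∞ G]
  {P : SplitManinPair ED D EG G}
  {ES : Type*} [NormedAddCommGroup ES] [NormedSpace ℝ ES] [FiniteDimensional ℝ ES]
  [ChartedSpace ES P.S] [IsManifold 𝓘(ℝ, ES) ∞ P.S]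
  {EM : Type*} [NormedAddCommGroup EM] [NormedSpace ℝ EM] [FiniteDimensional ℝ EM]
  {M : Type*} [TopologicalSpace M] [ChartedSpace EM M] [IsManifold 𝓘(ℝ, EM) ∞ M]
  [MulAction G M] [ContMDiffSMul 𝓘(ℝ, EG) 𝓘(ℝ, EM) ∞ G M]
  (H : HamiltonianSpace P ES EM M) {y : P.S}

theorem val_smul (g : G) (q : H.Preimage y) : (g • q).1 = g • q.1 := rfl

theorem continuous_val : Continuous (fun q : H.Preimage y => q.1) :=
  continuous_iff_le_induced.2 inf_le_left

theorem continuous_toOrbit : Continuous (H.toOrbit y) :=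
  continuous_iff_le_induced.2 inf_le_right

theorem nhds_preimage (q : H.Preimage y) :
    𝓝 q = Filter.comap (fun q : H.Preimage y => q.1) (𝓝 q.1) ⊓
      Filter.comap (H.toOrbit y) (𝓝 (H.toOrbit y q)) :=
  nhds_inf.trans (congrArg₂ _ (nhds_induced _ _) (nhds_induced _ _))

theorem tendsto_preimage_iff {Z : Type*} {l : Filter Z} {f : Z → H.Preimage y} {q : H.Preimage y} :
    Filter.Tendsto f l (𝓝 q) ↔ Filter.Tendsto (fun z => (f z).1) l (𝓝 q.1) ∧
      Filter.Tendsto (fun z => H.toOrbit y (f z)) l (𝓝 (H.toOrbit y q)) := by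
  rw [nhds_preimage, Filter.tendsto_inf, Filter.tendsto_comap_iff, Filter.tendsto_comap_iff]
  rfl

/-- Along a fibre of `J` the topology of `J⁻¹(𝒪)` is that of `M`. -/
theorem eventually_of_mem_fibre {q : H.Preimage y} {Q : M → Prop} (hQ : ∀ᶠ q' in 𝓝 q, Q q'.1) :
    ∀ᶠ z in 𝓝 q.1, H.J z = H.J q.1 → Q z := by
  rw [nhds_preimage] at hQ
  obtain ⟨A, hA, B, hB, hAB⟩ := Filter.mem_inf_iff_superset.1 (Filter.eventually_iff.1 hQ)
  obtain ⟨A', hA', hAA'⟩ := hA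
  obtain ⟨B', hB', hBB'⟩ := hB
  filter_upwards [hA'] with z hz hJ
  have hz' : ∃ g : G, P.incl g • y = H.J z := by rw [hJ]; exact q.2
  let q' : H.Preimage y := ⟨z, hz'⟩
  have h1 : H.toOrbit y q' = H.toOrbit y q := Subtype.ext hJ
  have h2 : H.toOrbit y q' ∈ B' := by rw [h1]; exact mem_of_mem_nhds hB'
  exact hAB (a := q') ⟨hAA' hz, hBB' h2⟩

/-- The component in `𝒪` is the orbit map after a right translation of `G`, hence continuous for the
quotient topology. So a function known only near `q` in the immersed topology can be differentiated
along the orbit. -/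
theorem continuous_orbit_preimage (q : H.Preimage y) : Continuous (fun g : G => g • q) := by
  have := topologicalGroup_of_lieGroup 𝓘(ℝ, EG) (G := G) ∞
  refine continuous_iff_continuousAt.2 fun g => H.tendsto_preimage_iff.2 ⟨?_, ?_⟩
  · exact (contMDiff_orbit (EG := EG) (EM := EM) q.1).continuous.continuousAt
  · obtain ⟨h, hh⟩ := q.2
    have h2 : (fun g : G => H.toOrbit y (g • q)) =
        P.orbitPoint y ∘ fun g => g * h := by
      funext g
      refine Subtype.ext ?_
      change H.J (g • q.1) = P.incl (g * h) • y
      rw [H.J_equivariant, map_mul, mul_smul, hh]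
    have h3 : Continuous (fun g : G => H.toOrbit y (g • q)) := by
      rw [h2]; exact (P.continuous_orbitPoint y).comp (continuous_mul_const h)
    exact h3.continuousAt

/-- The orbit map `G → 𝒪` is open. -/
theorem eventually_mem_orbit_image {q : H.Preimage y} (hq : H.J q.1 = y) {W : Set G}
    (hW : W ∈ 𝓝 (1 : G)) : ∀ᶠ q' in 𝓝 q, ∃ h ∈ W, P.incl h • y = H.J q'.1 := by
  have := topologicalGroup_of_lieGroup 𝓘(ℝ, EG) (G := G) ∞
  obtain ⟨V, hVW, hVo, hV1⟩ := mem_nhds_iff.1 hW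
  have hopen : IsOpen {s : P.DressingOrbit y | ∃ h ∈ V, P.incl h • y = s.1} := by
    rw [P.isOpen_dressingOrbit_iff]
    -- The preimage of the image of `V` is its saturation under the stabilizer of `y`, a union of
    -- right translates of `V`.
    have : P.orbitPoint y ⁻¹'
        {s : P.DressingOrbit y | ∃ h ∈ V, P.incl h • y = s.1} =
        ⋃ k ∈ {k : G | P.incl k • y = y}, (fun g => g * k) ⁻¹' V := by
      ext g
      simp only [Set.mem_preimage, Set.mem_setOf_eq, Set.mem_iUnion, exists_prop]
      constructor
      · rintro ⟨h, hh, he⟩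
        change P.incl h • y = P.incl g • y at he
        refine ⟨g⁻¹ * h, ?_, by simpa using hh⟩
        rw [map_mul, mul_smul, he, ← mul_smul, ← map_mul, inv_mul_cancel, map_one, one_smul]
      · rintro ⟨k, hk, hgk⟩
        refine ⟨g * k, hgk, ?_⟩
        rw [map_mul, mul_smul, hk]
        rfl
    rw [this]
    exact isOpen_biUnion fun k _ => hVo.preimage (continuous_mul_const k)
  have hmem : H.toOrbit y q ∈ {s : P.DressingOrbit y | ∃ h ∈ V, P.incl h • y = s.1} :=
    ⟨1, hV1, by rw [map_one, one_smul]; exact hq.symm⟩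
  filter_upwards [H.continuous_toOrbit.continuousAt (hopen.mem_nhds hmem)] with q' hq'
  obtain ⟨h, hh, he⟩ := hq'
  exact ⟨h, hVW hh, he⟩

theorem IsExtensionAt.eventually {H : HamiltonianSpace P ES EM M} {F : M → ℝ}
    {f : H.Preimage y → ℝ} {q : H.Preimage y} (h : IsExtensionAt F f q) :
    ∀ᶠ q' in 𝓝 q, IsExtensionAt F f q' := by
  filter_upwards [eventually_eventually_nhds.2 h.2] with q' hq'
  exact ⟨h.1, hq'⟩

theorem IsExtensionAt.apply_eq {H : HamiltonianSpace P ES EM M} {F : M → ℝ}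
    {f : H.Preimage y → ℝ} {q : H.Preimage y} (h : IsExtensionAt F f q) : F q.1 = f q :=
  h.2.self_of_nhds

/-- All points of `J⁻¹(𝒪)` are regular. -/
theorem surjective_mfderiv_J
    (hdress : ∀ a : D, ContMDiff 𝓘(ℝ, ES) 𝓘(ℝ, ES) ∞ (fun s : P.S => a • s))
    (hy : H.IsRegularValue y) (q : H.Preimage y) :
    Function.Surjective (mfderiv 𝓘(ℝ, EM) 𝓘(ℝ, ES) H.J q.1) := by
  obtain ⟨g, hg⟩ := q.2
  set p : M := g⁻¹ • q.1 with hp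
  have hJp : H.J p = y := by
    rw [hp, H.J_equivariant, ← hg, ← mul_smul, ← map_mul, inv_mul_cancel, map_one, one_smul]
  have hgp : g • p = q.1 := by rw [hp, smul_inv_smul]
  obtain ⟨Jq, hJq⟩ : ∃ T : EM →L[ℝ] ES, T = mfderiv 𝓘(ℝ, EM) 𝓘(ℝ, ES) H.J q.1 := ⟨_, rfl⟩
  obtain ⟨Jp, hJp'⟩ : ∃ T : EM →L[ℝ] ES, T = mfderiv 𝓘(ℝ, EM) 𝓘(ℝ, ES) H.J p := ⟨_, rfl⟩
  have hJqd : HasMFDerivAt 𝓘(ℝ, EM) 𝓘(ℝ, ES) H.J (g • p) Jq := by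
    rw [hgp, hJq]; exact ((H.J_smooth q.1).mdifferentiableAt (by simp)).hasMFDerivAt
  have hJpd : HasMFDerivAt 𝓘(ℝ, EM) 𝓘(ℝ, ES) H.J p Jp := by
    rw [hJp']; exact ((H.J_smooth p).mdifferentiableAt (by simp)).hasMFDerivAt
  obtain ⟨L, hL⟩ : ∃ L : EM →L[ℝ] EM,
      HasMFDerivAt 𝓘(ℝ, EM) 𝓘(ℝ, EM) (fun x : M => g • x) p L :=
    ⟨_, ((contMDiff_translation EG g p).mdifferentiableAt (by simp)).hasMFDerivAt⟩
  obtain ⟨S, hS⟩ : ∃ S : ES →L[ℝ] ES,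
      HasMFDerivAt 𝓘(ℝ, ES) 𝓘(ℝ, ES) (fun s : P.S => P.incl g • s) (H.J p) S :=
    ⟨_, ((hdress (P.incl g) (H.J p)).mdifferentiableAt (by simp)).hasMFDerivAt⟩
  obtain ⟨S', hS'⟩ : ∃ S' : ES →L[ℝ] ES, HasMFDerivAt 𝓘(ℝ, ES) 𝓘(ℝ, ES)
      (fun s : P.S => (P.incl g)⁻¹ • s) (P.incl g • H.J p) S' :=
    ⟨_, ((hdress (P.incl g)⁻¹ _).mdifferentiableAt (by simp)).hasMFDerivAt⟩
  have hS2 : HasMFDerivAt 𝓘(ℝ, ES) 𝓘(ℝ, ES) (fun s : P.S => P.incl g • s)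
      ((P.incl g)⁻¹ • (P.incl g • H.J p)) S := by rw [inv_smul_smul]; exact hS
  have hSS' : S ∘L S' = ContinuousLinearMap.id ℝ ES := by
    have h1 := HasMFDerivAt.comp (P.incl g • H.J p) hS2 hS'
    have h2 := (hasMFDerivAt_id (I := 𝓘(ℝ, ES)) (P.incl g • H.J p)).congr_of_eventuallyEq
      (f₁ := (fun s : P.S => P.incl g • s) ∘ fun s => (P.incl g)⁻¹ • s)
      (.of_forall fun s => by simp)
    exact hasMFDerivAt_unique h1 h2
  -- Differentiated equivariance. Since `S` has the right inverse `S'`, surjectivity passes from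
  -- `p`, which lies over `y`, to `q`.
  have hcomp : Jq ∘L L = S ∘L Jp := by
    have h1 := HasMFDerivAt.comp p hJqd hL
    have h2 := (HasMFDerivAt.comp p hS hJpd).congr_of_eventuallyEq
      (f₁ := H.J ∘ fun x : M => g • x) (.of_forall fun x => H.J_equivariant g x)
    exact hasMFDerivAt_unique h1 h2
  have hsurj : Function.Surjective Jp := by rw [hJp']; exact hy p hJp
  suffices h : Function.Surjective Jq by rw [hJq] at h; exact h
  intro w
  obtain ⟨u, hu⟩ := hsurj (S' w)
  refine ⟨L u, ?_⟩
  have h1 := DFunLike.congr_fun hcomp u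
  have h2 := DFunLike.congr_fun hSS' w
  change Jq (L u) = S (Jp u) at h1
  rw [h1, hu]
  exact h2

end Topology
end HamiltonianSpace
end QuasiPoisson

/-! ### The reduced Poisson bracket on invariant functions. -/

namespace QuasiPoisson

/-- The cobracket and trivector are only evaluated on zero covectors, where both arguments of the
bracket are `P.j 0`; this makes bilinearity of `lieBracketR` unnecessary. -/
theorem lieBracketR_self {ED : Type*} [NormedAddCommGroup ED] [NormedSpace ℝ ED]
    {D : Type*} [TopologicalSpace D] [ChartedSpace ED D] [Group D]
    (u : GroupLieAlgebra 𝓘(ℝ, ED) D) : lieBracketR u u = 0 := by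
  unfold lieBracketR
  rw [VectorField.mlieBracket_self]
  rfl

namespace HamiltonianSpace
section Bracket

set_option linter.unusedSectionVars false

variable {ED : Type*} [NormedAddCommGroup ED] [NormedSpace ℝ ED]
  {D : Type*} [TopologicalSpace D] [ChartedSpace ED D] [Group D]
  {EG : Type*} [NormedAddCommGroup EG] [NormedSpace ℝ EG] [FiniteDimensional ℝ EG]
  {G : Type*} [TopologicalSpace G] [ChartedSpace EG G] [Group G] [LieGroup 𝓘(ℝ, EG) ∞ G]
  {P : SplitManinPair ED D EG G}
  {ES : Type*} [NormedAddCommGroup ES] [NormedSpace ℝ ES] [FiniteDimensional ℝ ES]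
  [ChartedSpace ES P.S] [IsManifold 𝓘(ℝ, ES) ∞ P.S]
  {EM : Type*} [NormedAddCommGroup EM] [NormedSpace ℝ EM] [FiniteDimensional ℝ EM]
  {M : Type*} [TopologicalSpace M] [ChartedSpace EM M] [IsManifold 𝓘(ℝ, EM) ∞ M]
  [MulAction G M] [ContMDiffSMul 𝓘(ℝ, EG) 𝓘(ℝ, EM) ∞ G M]
  {H : HamiltonianSpace P ES EM M} {y : P.S}

/-- Differentials of extensions of invariant functions annihilate the orbit directions. -/
theorem IsExtensionAt.mvfderiv_comp_infAction {K : M → ℝ} {k : H.Preimage y → ℝ}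
    {q : H.Preimage y} (hK : IsExtensionAt K k q) (hk : ∀ (g : G) p, k (g • p) = k p) :
    mvfderiv 𝓘(ℝ, EM) K q.1 ∘L infAction EG G EM q.1 = 0 := by
  have h1 := hasMFDerivAt_comp_orbit (EG := EG) (G := G) hK.1 q.1
  have hT : Filter.Tendsto (fun g : G => g • q) (𝓝 1) (𝓝 q) := by
    simpa using (H.continuous_orbit_preimage q).tendsto 1
  have h2 := (hasMFDerivAt_const (I := 𝓘(ℝ, EG)) (I' := 𝓘(ℝ, ℝ)) (k q) (1 : G)
    ).congr_of_eventuallyEq (f₁ := fun a : G => K (a • q.1)) (by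
      filter_upwards [hT.eventually hK.2] with g hg
      rw [← hk g q, ← hg]
      rfl)
  exact hasMFDerivAt_unique h1 h2

variable (hreg : ∀ q : H.Preimage y, Function.Surjective (mfderiv 𝓘(ℝ, EM) 𝓘(ℝ, ES) H.J q.1))

include hreg in
-- The heart of the reduction: dF is pulled back along J from S, so by the moment condition its
-- Hamiltonian vector is tangent to the G-orbit, and dK kills orbit directions. No invariance of F
-- is required.
theorem bracket_eq_zero {F K : M → ℝ} {k : H.Preimage y → ℝ} {q : H.Preimage y}
    (hF : IsExtensionAt F (0 : H.Preimage y → ℝ) q) (hK : IsExtensionAt K k q)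
    (hk : ∀ (g : G) p, k (g • p) = k p) : H.π.bracket F K q.1 = 0 := by
  obtain ⟨α, hα⟩ := exists_mvfderiv_eq_comp H.J_smooth (hreg q) hF.1
    (H.eventually_of_mem_fibre hF.2)
  have h1 := DFunLike.congr_fun (hK.mvfderiv_comp_infAction hk) (P.sigmaDual (H.J q.1) α)
  unfold BivectorField.bracket
  rw [hα, H.moment]
  exact h1

theorem IsExtensionAt.sub {F F' : M → ℝ} {f : H.Preimage y → ℝ} {q : H.Preimage y}
    (hF : IsExtensionAt F f q) (hF' : IsExtensionAt F' f q) :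
    IsExtensionAt (F - F') (0 : H.Preimage y → ℝ) q := by
  refine ⟨hF.1.sub hF'.1, ?_⟩
  filter_upwards [hF.2, hF'.2] with q' h1 h2
  simp [h1, h2]

include hreg in
theorem bracket_congr_right {F K K' : M → ℝ} {f k : H.Preimage y → ℝ} {q : H.Preimage y}
    (hF : IsExtensionAt F f q) (hK : IsExtensionAt K k q) (hK' : IsExtensionAt K' k q)
    (hf : ∀ (g : G) p, f (g • p) = f p) : H.π.bracket F K q.1 = H.π.bracket F K' q.1 := by
  have h := bracket_eq_zero hreg (hK.sub hK') hF hf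
  rw [BivectorField.bracket_swap, BivectorField.bracket_sub_right _ _ hK.1 hK'.1] at h
  linarith

include hreg in
/-- The bracket of extensions of invariant functions does not depend on the extensions. -/
theorem bracket_congr {F F' K K' : M → ℝ} {f k : H.Preimage y → ℝ} {q : H.Preimage y}
    (hF : IsExtensionAt F f q) (hF' : IsExtensionAt F' f q)
    (hK : IsExtensionAt K k q) (hK' : IsExtensionAt K' k q)
    (hf : ∀ (g : G) p, f (g • p) = f p) (hk : ∀ (g : G) p, k (g • p) = k p) :
    H.π.bracket F K q.1 = H.π.bracket F' K' q.1 := by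
  rw [bracket_congr_right hreg hF hK hK' hf, BivectorField.bracket_swap,
    bracket_congr_right hreg hK' hF hF' hk, ← BivectorField.bracket_swap]

/-- `F` also extends `f` at nearby points of J⁻¹(𝒪), so its differential kills orbit directions
there as well. This removes the two correction terms in the Lie derivative of π. -/
theorem IsExtensionAt.derivAlong {F : M → ℝ} {f : H.Preimage y → ℝ} {q : H.Preimage y}
    (hF : IsExtensionAt F f q) (hf : ∀ (g : G) p, f (g • p) = f p)
    (v : GroupLieAlgebra 𝓘(ℝ, EG) G) :
    IsExtensionAt (derivAlong (fun x => infAction EG G EM x v) F) (0 : H.Preimage y → ℝ) q := by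
  refine ⟨derivAlong_infAction_smooth hF.1 v, ?_⟩
  filter_upwards [hF.eventually] with q' hq'
  exact DFunLike.congr_fun (hq'.mvfderiv_comp_infAction hf) v

include hreg in
/-- The bracket of extensions of invariant functions is infinitesimally invariant. -/
theorem mvfderiv_bracket_comp_infAction {F K : M → ℝ} {f k : H.Preimage y → ℝ}
    {q : H.Preimage y} (hF : IsExtensionAt F f q) (hK : IsExtensionAt K k q)
    (hf : ∀ (g : G) p, f (g • p) = f p) (hk : ∀ (g : G) p, k (g • p) = k p) :
    mvfderiv 𝓘(ℝ, EM) (H.π.bracket F K) q.1 ∘L infAction EG G EM q.1 = 0 := by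
  ext v
  have h := H.lie_eq v F K hF.1 hK.1 q.1
  rw [hF.mvfderiv_comp_infAction hf, hK.mvfderiv_comp_infAction hk] at h
  unfold SplitManinPair.cobracket BivectorField.lieDerivative at h
  -- The cobracket term vanishes on zero covectors and the correction terms vanish by
  -- `bracket_eq_zero`; only the derivative of the bracket along the orbit remains.
  rw [lieBracketR_self, map_zero, LinearMap.zero_apply, neg_zero, Pi.sub_apply, Pi.sub_apply,
    bracket_eq_zero hreg (hF.derivAlong hf v) hK hk, BivectorField.bracket_swap _ F,
    bracket_eq_zero hreg (hK.derivAlong hk v) hF hf, neg_zero, sub_zero, sub_zero] at h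
  exact h

include hreg in
-- Infinitesimal invariance holds at `g • q` for every `g` near `1`, because `F` and `K` remain
-- extensions there. So the bracket along the orbit has zero derivative on a neighbourhood of `1`.
theorem eventually_bracket_smul_eq {F K : M → ℝ} {f k : H.Preimage y → ℝ}
    {q : H.Preimage y} (hF : IsExtensionAt F f q) (hK : IsExtensionAt K k q)
    (hf : ∀ (g : G) p, f (g • p) = f p) (hk : ∀ (g : G) p, k (g • p) = k p) :
    ∀ᶠ g in 𝓝 (1 : G), H.π.bracket F K (g • q.1) = H.π.bracket F K q.1 := by
  have hT : Filter.Tendsto (fun g : G => g • q) (𝓝 1) (𝓝 q) := by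
    simpa using (H.continuous_orbit_preimage q).tendsto 1
  have hL := H.π.bracket_smooth hF.1 hK.1
  set L := H.π.bracket F K with hLdef
  have hder : ∀ᶠ g in 𝓝 (1 : G),
      HasMFDerivAt 𝓘(ℝ, EG) 𝓘(ℝ, ℝ) (fun a : G => L (a • q.1)) g (0 : EG →L[ℝ] ℝ) := by
    filter_upwards [hT.eventually hF.eventually, hT.eventually hK.eventually] with g h1 h2
    have h3 := hasMFDerivAt_comp_orbit (EG := EG) (G := G) hL (g • q).1
    have h30 : mvfderiv 𝓘(ℝ, EM) L (g • q).1 ∘L infAction EG G EM (g • q).1 = 0 :=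
      mvfderiv_bracket_comp_infAction hreg h1 h2 hf hk
    -- Since `a • q = (a * g⁻¹) • (g • q)`, right translation turns the derivative at `g` into one
    -- at `1` along the orbit of `g • q`.
    have h4 : HasMFDerivAt 𝓘(ℝ, EG) 𝓘(ℝ, ℝ) (fun a : G => L (a • (g • q).1)) (g * g⁻¹)
        (0 : EG →L[ℝ] ℝ) := by rw [mul_inv_cancel]; exact h3.congr_mfderiv h30
    have h5 : MDifferentiableAt 𝓘(ℝ, EG) 𝓘(ℝ, EG) (fun a : G => a * g⁻¹) g :=
      (contMDiff_mul_right (I := 𝓘(ℝ, EG)) (n := ∞) (a := g⁻¹) g).mdifferentiableAt (by simp)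
    have h6 := HasMFDerivAt.comp g h4 h5.hasMFDerivAt
    refine (h6.congr_of_eventuallyEq (f₁ := fun a : G => L (a • q.1))
      (.of_forall fun a => ?_)).congr_mfderiv (ContinuousLinearMap.zero_comp _)
    simp only [Function.comp_apply, val_smul, ← mul_smul, inv_mul_cancel_right]
  obtain ⟨c⟩ := nonempty_centeredChart (E := EG) (1 : G)
  have hd : ∀ᶠ t in 𝓝 (0 : EG), HasFDerivAt (fun t => L (c.param t • q.1)) (0 : EG →L[ℝ] ℝ) t := by
    filter_upwards [c.tendsto_param.eventually hder, c.param_smooth] with t h1 h2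
    have h3 := HasMFDerivAt.comp t h1 (h2.mdifferentiableAt (by simp)).hasMFDerivAt
    have h4 := h3.congr_mfderiv (ContinuousLinearMap.zero_comp _)
    exact hasMFDerivAt_iff_hasFDerivAt.1 h4
  have hconst := eventually_eq_of_fderiv_eq_zero (hd.mono fun t h => h.differentiableAt)
    (hd.mono fun t h => h.fderiv)
  filter_upwards [c.tendsto_coord.eventually hconst, c.param_coord] with g h1 h2
  simpa only [h2, c.param_zero, one_smul] using h1

/-- A choice of a smooth extension near each point. -/
noncomputable def extensionAt (f : H.invariantFunctions y) (q : H.Preimage y) : M → ℝ :=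
  Classical.choose (f.2.1 q)

theorem isExtensionAt_extensionAt (f : H.invariantFunctions y) (q : H.Preimage y) :
    IsExtensionAt (extensionAt f q) f.1 q := Classical.choose_spec (f.2.1 q)

/-- The reduced bracket of two invariant functions, as a function on `J⁻¹(𝒪)`. -/
noncomputable def reducedFun (f k : H.invariantFunctions y) (q : H.Preimage y) : ℝ :=
  H.π.bracket (extensionAt f q) (extensionAt k q) q.1

include hreg in
theorem reducedFun_eq {f k : H.invariantFunctions y} {q : H.Preimage y} {F K : M → ℝ}
    (hF : IsExtensionAt F f.1 q) (hK : IsExtensionAt K k.1 q) :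
    reducedFun f k q = H.π.bracket F K q.1 :=
  bracket_congr hreg (isExtensionAt_extensionAt f q) hF (isExtensionAt_extensionAt k q) hK
    f.2.2 k.2.2

include hreg in
-- `reducedFun` chooses new extensions at each point, but independence of the choice lets one fixed
-- pair compute it near `q`. This gives smoothness and permits iterated brackets.
theorem isExtensionAt_bracket {f k : H.invariantFunctions y} {q : H.Preimage y} {F K : M → ℝ}
    (hF : IsExtensionAt F f.1 q) (hK : IsExtensionAt K k.1 q) :
    IsExtensionAt (H.π.bracket F K) (reducedFun f k) q := by
  refine ⟨H.π.bracket_smooth hF.1 hK.1, ?_⟩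
  filter_upwards [hF.eventually, hK.eventually] with q' h1 h2
  exact (reducedFun_eq hreg h1 h2).symm

include hreg in
-- Local invariance at every point makes the function locally constant along the orbit map, and G is
-- connected.
theorem reducedFun_smul [ConnectedSpace G] (f k : H.invariantFunctions y) (g : G)
    (q : H.Preimage y) : reducedFun f k (g • q) = reducedFun f k q := by
  have := topologicalGroup_of_lieGroup 𝓘(ℝ, EG) (G := G) ∞
  have hloc : ∀ q : H.Preimage y, ∀ᶠ h in 𝓝 (1 : G),
      reducedFun f k (h • q) = reducedFun f k q := by
    intro q
    have hF := isExtensionAt_extensionAt f q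
    have hK := isExtensionAt_extensionAt k q
    have hT : Filter.Tendsto (fun g : G => g • q) (𝓝 1) (𝓝 q) := by
      simpa using (H.continuous_orbit_preimage q).tendsto 1
    filter_upwards [eventually_bracket_smul_eq hreg hF hK f.2.2 k.2.2, hT.eventually hF.eventually,
      hT.eventually hK.eventually] with h h1 h2 h3
    rw [reducedFun_eq hreg h2 h3, reducedFun_eq hreg hF hK]
    exact h1
  have hlc : IsLocallyConstant (fun h : G => reducedFun f k (h • q)) := by
    refine (IsLocallyConstant.iff_eventually_eq _).2 fun h₀ => ?_
    have hT : Filter.Tendsto (fun h : G => h * h₀⁻¹) (𝓝 h₀) (𝓝 1) := by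
      simpa using (continuous_mul_const h₀⁻¹).tendsto h₀
    filter_upwards [hT.eventually (hloc (h₀ • q))] with h hh
    rwa [← mul_smul, inv_mul_cancel_right] at hh
  have := hlc.apply_eq_of_preconnectedSpace g 1
  simpa only [one_smul] using this

/-- The reduced bracket of two invariant functions. -/
noncomputable def reducedElem [ConnectedSpace G] (f k : H.invariantFunctions y) : H.invariantFunctions y :=
  ⟨reducedFun f k, fun q => ⟨_, isExtensionAt_bracket hreg (isExtensionAt_extensionAt f q)
    (isExtensionAt_extensionAt k q)⟩, reducedFun_smul hreg f k⟩

theorem IsExtensionAt.add {F K : M → ℝ} {f k : H.Preimage y → ℝ} {q : H.Preimage y}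
    (hF : IsExtensionAt F f q) (hK : IsExtensionAt K k q) :
    IsExtensionAt (F + K) (f + k) q := by
  refine ⟨hF.1.add hK.1, ?_⟩
  filter_upwards [hF.2, hK.2] with q' h1 h2
  simp [h1, h2]

theorem IsExtensionAt.mul {F K : M → ℝ} {f k : H.Preimage y → ℝ} {q : H.Preimage y}
    (hF : IsExtensionAt F f q) (hK : IsExtensionAt K k q) :
    IsExtensionAt (F * K) (f * k) q := by
  refine ⟨hF.1.mul hK.1, ?_⟩
  filter_upwards [hF.2, hK.2] with q' h1 h2
  simp [h1, h2]

theorem IsExtensionAt.smul {F : M → ℝ} {f : H.Preimage y → ℝ} {q : H.Preimage y}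
    (hF : IsExtensionAt F f q) (c : ℝ) : IsExtensionAt (fun z => c * F z) (c • f) q := by
  refine ⟨contMDiff_const.mul hF.1, ?_⟩
  filter_upwards [hF.2] with q' h1
  simp [h1]

include hreg in
theorem reducedFun_swap (f k : H.invariantFunctions y) (q : H.Preimage y) :
    reducedFun f k q = - reducedFun k f q :=
  BivectorField.bracket_swap _ _ _ _

include hreg in
theorem reducedFun_add_right (f k k' : H.invariantFunctions y) (q : H.Preimage y) :
    reducedFun f (k + k') q = reducedFun f k q + reducedFun f k' q := by
  have hF := isExtensionAt_extensionAt f q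
  have hK := isExtensionAt_extensionAt k q
  have hK' := isExtensionAt_extensionAt k' q
  rw [reducedFun_eq hreg hF (K := extensionAt k q + extensionAt k' q) (hK.add hK'),
    BivectorField.bracket_add_right _ _ hK.1 hK'.1]
  rfl

include hreg in
theorem reducedFun_smul_right (f k : H.invariantFunctions y) (c : ℝ) (q : H.Preimage y) :
    reducedFun f (c • k) q = c * reducedFun f k q := by
  have hF := isExtensionAt_extensionAt f q
  have hK := isExtensionAt_extensionAt k q
  rw [reducedFun_eq hreg hF (K := fun z => c * extensionAt k q z) (hK.smul c),
    BivectorField.bracket_const_mul_right _ _ _ hK.1]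
  rfl

include hreg in
theorem reducedFun_mul_right (f k k' : H.invariantFunctions y) (q : H.Preimage y) :
    reducedFun f (k * k') q = reducedFun f k q * k'.1 q + k.1 q * reducedFun f k' q := by
  have hF := isExtensionAt_extensionAt f q
  have hK := isExtensionAt_extensionAt k q
  have hK' := isExtensionAt_extensionAt k' q
  rw [reducedFun_eq hreg hF (K := extensionAt k q * extensionAt k' q) (hK.mul hK'),
    BivectorField.bracket_mul_right _ _ hK.1 hK'.1, hK.apply_eq, hK'.apply_eq]
  rfl

include hreg in
-- With brackets of extensions serving as extensions, the Jacobiator is ½[π, π] on three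
-- differentials that kill orbit directions, that is, χ on zero covectors.
theorem reducedFun_jacobi [ConnectedSpace G] (f k l : H.invariantFunctions y)
    (q : H.Preimage y) :
    reducedFun f (reducedElem hreg k l) q + reducedFun k (reducedElem hreg l f) q +
      reducedFun l (reducedElem hreg f k) q = 0 := by
  have hF := isExtensionAt_extensionAt f q
  have hK := isExtensionAt_extensionAt k q
  have hL := isExtensionAt_extensionAt l q
  rw [reducedFun_eq hreg (k := reducedElem hreg k l) hF (isExtensionAt_bracket hreg hK hL),
    reducedFun_eq hreg (k := reducedElem hreg l f) hK (isExtensionAt_bracket hreg hL hF),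
    reducedFun_eq hreg (k := reducedElem hreg f k) hL (isExtensionAt_bracket hreg hF hK)]
  have h := H.schouten_eq _ _ _ hF.1 hK.1 hL.1 q.1
  rw [hF.mvfderiv_comp_infAction f.2.2, hK.mvfderiv_comp_infAction k.2.2,
    hL.mvfderiv_comp_infAction l.2.2] at h
  unfold SplitManinPair.trivector at h
  have h0 : P.j (0 : GroupLieAlgebra 𝓘(ℝ, EG) G →L[ℝ] ℝ).toLinearMap = 0 := map_zero P.j
  rw [lieBracketR_self, map_zero, LinearMap.zero_apply] at h
  unfold BivectorField.schouten at h
  simp only [Pi.add_apply] at h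
  linarith

/-- The reduced Poisson bracket. -/
noncomputable def reducedBracket [ConnectedSpace G] : PoissonBracket (H.invariantFunctions y) where
  bracket := LinearMap.mk₂ ℝ (reducedElem hreg)
    (fun f f' k => Subtype.ext <| funext fun q => by
      change reducedFun (f + f') k q = reducedFun f k q + reducedFun f' k q
      rw [reducedFun_swap hreg, reducedFun_add_right hreg, reducedFun_swap hreg f,
        reducedFun_swap hreg f', neg_add])
    (fun c f k => Subtype.ext <| funext fun q => by
      change reducedFun (c • f) k q = c * reducedFun f k q
      rw [reducedFun_swap hreg, reducedFun_smul_right hreg, reducedFun_swap hreg f,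
        mul_neg])
    (fun f k k' => Subtype.ext <| funext fun q => reducedFun_add_right hreg f k k' q)
    (fun c f k => Subtype.ext <| funext fun q => reducedFun_smul_right hreg f k c q)
  bracket_self f := Subtype.ext <| funext fun q => BivectorField.bracket_self _ _ _
  jacobi f k l := Subtype.ext <| funext fun q => reducedFun_jacobi hreg f k l q
  leibniz f k l := Subtype.ext <| funext fun q => reducedFun_mul_right hreg f k l q

theorem isReducedBracket_reducedBracket [ConnectedSpace G] :
    H.IsReducedBracket (reducedBracket hreg) :=
  fun _ _ _ _ _ hF hK => reducedFun_eq hreg hF hK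

theorem IsReducedBracket.unique {br br' : PoissonBracket (H.invariantFunctions y)}
    (h : H.IsReducedBracket br) (h' : H.IsReducedBracket br') : br' = br := by
  refine PoissonBracket.ext (LinearMap.ext₂ fun f k => Subtype.ext <| funext fun q => ?_)
  rw [h f k q _ _ (isExtensionAt_extensionAt f q) (isExtensionAt_extensionAt k q),
    h' f k q _ _ (isExtensionAt_extensionAt f q) (isExtensionAt_extensionAt k q)]

end Bracket
end HamiltonianSpace
end QuasiPoisson

/-! ### Slices to the isotropy directions inside a fibre of J. -/

namespace QuasiPoisson
section LinearAlgebra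

set_option linter.unusedSectionVars false

variable {EG EM ES : Type*} [NormedAddCommGroup EG] [NormedSpace ℝ EG] [FiniteDimensional ℝ EG]
  [NormedAddCommGroup EM] [NormedSpace ℝ EM] [FiniteDimensional ℝ EM]
  [NormedAddCommGroup ES] [NormedSpace ℝ ES] [FiniteDimensional ℝ ES]

/-- A linear slice to `ρ` inside the kernel of `T`, of the expected dimension. -/
theorem exists_linear_slice (T : EM →L[ℝ] ES) (hT : Function.Surjective T) (ρ : EG →L[ℝ] EM)
    (hρ : ∀ v, ρ v = 0 → v = 0) (K : Submodule ℝ EM) (hK : ∀ w, w ∈ K ↔ T w = 0)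
    (N : Submodule ℝ EG) (hN : ∀ v, v ∈ N ↔ T (ρ v) = 0) (d : ℕ)
    (hd : d = Module.finrank ℝ EM - (Module.finrank ℝ ES + Module.finrank ℝ N)) :
    ∃ L : EuclideanSpace ℝ (Fin d) →L[ℝ] K,
      (∃ e : (N × EuclideanSpace ℝ (Fin d)) ≃L[ℝ] K, ∀ t c, (e (t, c) : EM) = ρ t + L c) ∧
      ∀ v c, ρ v + L c = 0 → v = 0 ∧ c = 0 := by
  let ι : N →ₗ[ℝ] K := LinearMap.codRestrict K (ρ.toLinearMap ∘ₗ N.subtype)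
    fun t => (hK _).2 ((hN _).1 t.2)
  have hι : ∀ t, (ι t : EM) = ρ t := fun t => rfl
  have hιinj : Function.Injective ι := by
    rw [injective_iff_map_eq_zero]
    intro t ht
    exact Subtype.ext (hρ t (by rw [← hι, ht]; rfl))
  -- The slice directions: a complement of ρ(N) in ker T. Rank-nullity shows that its dimension is
  -- `d` and that the natural-number subtraction does not truncate.
  obtain ⟨C, hC⟩ := Submodule.exists_isCompl (LinearMap.range ι)
  have hker : LinearMap.ker T.toLinearMap = K := by ext w; exact (hK w).symm
  have h1 := LinearMap.finrank_range_add_finrank_ker T.toLinearMap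
  rw [LinearMap.range_eq_top.2 hT, finrank_top, hker] at h1
  have h2 := Submodule.finrank_add_eq_of_isCompl hC
  rw [LinearMap.finrank_range_of_inj hιinj] at h2
  have hCd : Module.finrank ℝ (EuclideanSpace ℝ (Fin d)) = Module.finrank ℝ C := by
    rw [finrank_euclideanSpace_fin]; omega
  let L₀ := LinearEquiv.ofFinrankEq (EuclideanSpace ℝ (Fin d)) C hCd
  let L : EuclideanSpace ℝ (Fin d) →L[ℝ] K := (C.subtype ∘ₗ L₀.toLinearMap).toContinuousLinearMap
  have hLC : ∀ c, L c ∈ C := fun c => (L₀ c).2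
  have hL0 : ∀ c, L c = 0 → c = 0 := fun c hc =>
    (LinearEquiv.map_eq_zero_iff L₀).1 (Subtype.ext hc)
  have hzero : ∀ v c, ρ v + L c = 0 → v = 0 ∧ c = 0 := by
    intro v c h
    have hρv : ρ v = -(L c : EM) := eq_neg_of_add_eq_zero_left h
    -- A relation `ρ v + L c = 0` with arbitrary `v` forces `ρ v` into ker T, hence `v` into `N`,
    -- where complementarity applies.
    have hvK : T (ρ v) = 0 := by
      rw [← hK, hρv]; exact K.neg_mem (L c).2
    set t : N := ⟨v, (hN v).2 hvK⟩ with ht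
    have h3 : ι t = -L c := Subtype.ext hρv
    have h4 : L c ∈ LinearMap.range ι := ⟨-t, by rw [map_neg, h3, neg_neg]⟩
    have h5 : L c = 0 := by
      have := hC.disjoint.le_bot (show L c ∈ LinearMap.range ι ⊓ C from ⟨h4, hLC c⟩)
      simpa using this
    refine ⟨hρ v ?_, hL0 c h5⟩
    rw [hρv, h5]; simp
  refine ⟨L, ?_, hzero⟩
  let Λ : N × EuclideanSpace ℝ (Fin d) →ₗ[ℝ] K := LinearMap.coprod ι L.toLinearMap
  have hΛinj : Function.Injective Λ := by
    rw [injective_iff_map_eq_zero]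
    rintro ⟨t, c⟩ h
    have h' : ρ t + L c = 0 := congrArg Subtype.val h
    obtain ⟨h1, h2⟩ := hzero _ _ h'
    exact Prod.ext (Subtype.ext h1) h2
  have hfin : Module.finrank ℝ (N × EuclideanSpace ℝ (Fin d)) = Module.finrank ℝ K := by
    rw [Module.finrank_prod, hCd, h2]
  exact ⟨(LinearEquiv.ofInjectiveOfFinrankEq Λ hΛinj hfin).toContinuousLinearEquiv,
    fun t c => rfl⟩

theorem ContinuousLinearMap.eq_of_partials {V W Z : Type*} [NormedAddCommGroup V] [NormedSpace ℝ V]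
    [NormedAddCommGroup W] [NormedSpace ℝ W] [NormedAddCommGroup Z] [NormedSpace ℝ Z]
    {D : V × W →L[ℝ] Z} {A : V →L[ℝ] Z} {B : W →L[ℝ] Z}
    (hA : D ∘L ContinuousLinearMap.inl ℝ V W = A) (hB : D ∘L ContinuousLinearMap.inr ℝ V W = B)
    (v : V) (w : W) : D (v, w) = A v + B w := by
  rw [← hA, ← hB, ContinuousLinearMap.comp_apply, ContinuousLinearMap.comp_apply, ← map_add]
  simp

end LinearAlgebra

section Slice

set_option linter.unusedSectionVars false

variable {EG : Type*} [NormedAddCommGroup EG] [NormedSpace ℝ EG] [FiniteDimensional ℝ EG]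
  {G : Type*} [TopologicalSpace G] [ChartedSpace EG G] [Group G] [LieGroup 𝓘(ℝ, EG) ∞ G]
  {ES : Type*} [NormedAddCommGroup ES] [NormedSpace ℝ ES] [FiniteDimensional ℝ ES]
  {S : Type*} [TopologicalSpace S] [ChartedSpace ES S] [IsManifold 𝓘(ℝ, ES) ∞ S]
  {EM : Type*} [NormedAddCommGroup EM] [NormedSpace ℝ EM] [FiniteDimensional ℝ EM]
  {M : Type*} [TopologicalSpace M] [ChartedSpace EM M] [IsManifold 𝓘(ℝ, EM) ∞ M]
  [MulAction G M] [ContMDiffSMul 𝓘(ℝ, EG) 𝓘(ℝ, EM) ∞ G M]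

/-- The map `(v, c) ↦ γ v • τ c` of vector spaces, with its derivative. -/
theorem smul_param_smooth {V W : Type*} [NormedAddCommGroup V] [NormedSpace ℝ V]
    [NormedAddCommGroup W] [NormedSpace ℝ W] {γ : V → G} {τ : W → M}
    (hγ : ∀ᶠ v in 𝓝 0, ContMDiffAt 𝓘(ℝ, V) 𝓘(ℝ, EG) ∞ γ v)
    (hτ : ∀ᶠ w in 𝓝 0, ContMDiffAt 𝓘(ℝ, W) 𝓘(ℝ, EM) ∞ τ w) :
    ∀ᶠ p in 𝓝 (0 : V × W), ContMDiffAt 𝓘(ℝ, V × W) 𝓘(ℝ, EM) ∞ (fun p => γ p.1 • τ p.2) p := by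
  have h1 : Filter.Tendsto (Prod.fst : V × W → V) (𝓝 0) (𝓝 0) := continuous_fst.tendsto 0
  have h2 : Filter.Tendsto (Prod.snd : V × W → W) (𝓝 0) (𝓝 0) := continuous_snd.tendsto 0
  filter_upwards [h1.eventually hγ, h2.eventually hτ] with p hp1 hp2
  exact ContMDiffAt.smul (f := fun p : V × W => γ p.1) (g := fun p : V × W => τ p.2)
    (ContMDiffAt.comp p hp1 contDiff_fst.contMDiff.contMDiffAt)
    (ContMDiffAt.comp p hp2 contDiff_snd.contMDiff.contMDiffAt)

/-- The derivative is determined by the two axes: on one the map is `γ v • x`, on the other it is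
`τ`. -/
theorem hasMFDerivAt_smul_param {V W : Type*} [NormedAddCommGroup V] [NormedSpace ℝ V]
    [NormedAddCommGroup W] [NormedSpace ℝ W] {γ : V → G} {τ : W → M} {x : M}
    (hγ : ∀ᶠ v in 𝓝 0, ContMDiffAt 𝓘(ℝ, V) 𝓘(ℝ, EG) ∞ γ v)
    (hτ : ∀ᶠ w in 𝓝 0, ContMDiffAt 𝓘(ℝ, W) 𝓘(ℝ, EM) ∞ τ w) (hγ0 : γ 0 = 1) (hτ0 : τ 0 = x)
    {γ' : V →L[ℝ] EG} (hγ' : HasMFDerivAt 𝓘(ℝ, V) 𝓘(ℝ, EG) γ 0 γ')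
    {τ' : W →L[ℝ] EM} (hτ' : HasMFDerivAt 𝓘(ℝ, W) 𝓘(ℝ, EM) τ 0 τ')
    {ρ : EG →L[ℝ] EM} (hρ : ρ = infAction EG G EM x) :
    ∃ D : V × W →L[ℝ] EM,
      HasMFDerivAt 𝓘(ℝ, V × W) 𝓘(ℝ, EM) (fun p : V × W => γ p.1 • τ p.2) 0 D ∧
      ∀ v w, D (v, w) = ρ (γ' v) + τ' w := by
  obtain ⟨D, hD⟩ : ∃ D : V × W →L[ℝ] EM,
      HasMFDerivAt 𝓘(ℝ, V × W) 𝓘(ℝ, EM) (fun p : V × W => γ p.1 • τ p.2) 0 D :=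
    ⟨_, ((smul_param_smooth (EG := EG) hγ hτ).self_of_nhds.mdifferentiableAt
      (by simp)).hasMFDerivAt⟩
  refine ⟨D, hD, ContinuousLinearMap.eq_of_partials (A := ρ ∘L γ') (B := τ') ?_ ?_⟩
  · have h1 : HasMFDerivAt 𝓘(ℝ, V) 𝓘(ℝ, V × W) (fun v : V => (v, (0 : W))) 0
        (ContinuousLinearMap.inl ℝ V W) :=
      (ContinuousLinearMap.inl ℝ V W).hasFDerivAt.hasMFDerivAt
    have hD' : HasMFDerivAt 𝓘(ℝ, V × W) 𝓘(ℝ, EM) (fun p : V × W => γ p.1 • τ p.2)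
      ((fun v : V => (v, (0 : W))) 0) D := hD
    have h2 := HasMFDerivAt.comp (0 : V) hD' h1
    have h3 : HasMFDerivAt 𝓘(ℝ, EG) 𝓘(ℝ, EM) (fun g : G => g • x) (γ 0) ρ := by
      rw [hγ0, hρ]; exact hasMFDerivAt_infAction x
    have h4 := (HasMFDerivAt.comp (0 : V) h3 hγ').congr_of_eventuallyEq
      (f₁ := (fun p : V × W => γ p.1 • τ p.2) ∘ fun v : V => (v, (0 : W)))
      (.of_forall fun v => by simp [hτ0])
    exact hasMFDerivAt_unique h2 h4
  · have h1 : HasMFDerivAt 𝓘(ℝ, W) 𝓘(ℝ, V × W) (fun w : W => ((0 : V), w)) 0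
        (ContinuousLinearMap.inr ℝ V W) :=
      (ContinuousLinearMap.inr ℝ V W).hasFDerivAt.hasMFDerivAt
    have hD' : HasMFDerivAt 𝓘(ℝ, V × W) 𝓘(ℝ, EM) (fun p : V × W => γ p.1 • τ p.2)
      ((fun w : W => ((0 : V), w)) 0) D := hD
    have h2 := HasMFDerivAt.comp (0 : W) hD' h1
    have h4 := hτ'.congr_of_eventuallyEq
      (f₁ := (fun p : V × W => γ p.1 • τ p.2) ∘ fun w : W => ((0 : V), w))
      (.of_forall fun v => by simp [hγ0])
    exact hasMFDerivAt_unique h2 h4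

/-- The slice `τ` is the fibre chart restricted to a complement of the isotropy directions. Moving
it by a chart of G gives an immersion into M, whose local retraction yields `r`; moving it by a
chart of the isotropy group gives a local parametrization of the fibre, which yields the covering
statement. The latter is asserted at all `c₀` near `0`, so that it can produce open charts. -/
theorem exists_fibre_slice {J : M → S} (hJ : ContMDiff 𝓘(ℝ, EM) 𝓘(ℝ, ES) ∞ J)
    (act : G → S → S) (hact : ∀ g, ContMDiff 𝓘(ℝ, ES) 𝓘(ℝ, ES) ∞ (act g))
    (hmul : ∀ g h s, act (g * h) s = act g (act h s)) (hone : ∀ s, act 1 s = s)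
    (hequiv : ∀ (g : G) x, J (g • x) = act g (J x)) {x : M}
    (horb : ContMDiff 𝓘(ℝ, EG) 𝓘(ℝ, ES) ∞ (fun g : G => act g (J x)))
    (hsurj : Function.Surjective (mfderiv 𝓘(ℝ, EM) 𝓘(ℝ, ES) J x))
    (hinj : ∀ v, infAction EG G EM x v = 0 → v = 0)
    (N : Submodule ℝ EG) (hN : ∀ v : TangentSpace 𝓘(ℝ, EG) (1 : G),
      v ∈ N ↔ mfderiv 𝓘(ℝ, EG) 𝓘(ℝ, ES) (fun g : G => act g (J x)) 1 v = 0) (d : ℕ)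
    (hd : d = Module.finrank ℝ EM - (Module.finrank ℝ ES + Module.finrank ℝ N)) :
    ∃ (τ : EuclideanSpace ℝ (Fin d) → M) (r : M → EuclideanSpace ℝ (Fin d)), τ 0 = x ∧
      (∀ᶠ c in 𝓝 0, ContMDiffAt 𝓘(ℝ, EuclideanSpace ℝ (Fin d)) 𝓘(ℝ, EM) ∞ τ c) ∧
      (∀ᶠ c in 𝓝 0, J (τ c) = J x) ∧
      (∀ᶠ z in 𝓝 x, ContMDiffAt 𝓘(ℝ, EM) 𝓘(ℝ, EuclideanSpace ℝ (Fin d)) ∞ r z) ∧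
      (∃ W ∈ 𝓝 (1 : G), ∀ᶠ c in 𝓝 0, ∀ g ∈ W, r (g • τ c) = c) ∧
      ∀ᶠ c₀ in 𝓝 0, ∀ W ∈ 𝓝 (1 : G), ∀ B ∈ 𝓝 c₀, ∀ᶠ z in 𝓝 (τ c₀), J z = J x →
        ∃ g ∈ W, ∃ c ∈ B, z = g • τ c := by
  obtain ⟨T, hT⟩ : ∃ T : EM →L[ℝ] ES, T = mfderiv 𝓘(ℝ, EM) 𝓘(ℝ, ES) J x := ⟨_, rfl⟩
  obtain ⟨ρ, hρ⟩ : ∃ ρ : EG →L[ℝ] EM, ρ = infAction EG G EM x := ⟨_, rfl⟩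
  set K : Submodule ℝ EM := LinearMap.ker T.toLinearMap with hKdef
  have hK : ∀ w, w ∈ K ↔ T w = 0 := fun w => Iff.rfl
  have hTsurj : Function.Surjective T := by rw [hT]; exact hsurj
  have hKM : ∀ w : TangentSpace 𝓘(ℝ, EM) x, w ∈ K ↔ mfderiv 𝓘(ℝ, EM) 𝓘(ℝ, ES) J x w = 0 := by
    rw [← hT]; exact fun w => Iff.rfl
  -- By equivariance the orbit map of `J x` is J along the orbit of `x`; so `N` is exactly the
  -- preimage of ker T under ρ.
  have hTρ : HasMFDerivAt 𝓘(ℝ, EG) 𝓘(ℝ, ES) (fun g : G => act g (J x)) 1 (T ∘L ρ) := by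
    have h1 : HasMFDerivAt 𝓘(ℝ, EM) 𝓘(ℝ, ES) J ((1 : G) • x) T := by
      rw [one_smul, hT]; exact ((hJ x).mdifferentiableAt (by simp)).hasMFDerivAt
    have h2 : HasMFDerivAt 𝓘(ℝ, EG) 𝓘(ℝ, EM) (fun g : G => g • x) 1 ρ := by
      rw [hρ]; exact hasMFDerivAt_infAction x
    exact (HasMFDerivAt.comp (1 : G) h1 h2).congr_of_eventuallyEq
      (.of_forall fun g => (hequiv g x).symm)
  have hN' : ∀ v, v ∈ N ↔ T (ρ v) = 0 := by
    intro v
    have h := hN v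
    rw [hTρ.mfderiv] at h
    exact h
  obtain ⟨L, ⟨e, he⟩, hL⟩ := exists_linear_slice T hTsurj ρ (by rw [hρ]; exact hinj) K hK N hN' d hd
  obtain ⟨κ, A, hκ0, hA0, hκs, hAs, hκd, hJκ, hAκ, hκA⟩ := exists_smooth_fibre_chart x hJ K hKM
    (.of_forall fun z => finrank_ker_le_of_surjective x z K hKM hsurj)
  obtain ⟨η, hη0, hηs, hηd, hη⟩ := exists_isotropy_chart horb act hact
    (fun g h => hmul g h (J x)) N hN
  obtain ⟨γ⟩ := nonempty_centeredChart (E := EG) (1 : G)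
  set τ : EuclideanSpace ℝ (Fin d) → M := fun c => κ (L c) with hτ
  have hLT : Filter.Tendsto L (𝓝 0) (𝓝 0) := by simpa using L.continuous.tendsto 0
  have hτ0 : τ 0 = x := by simp [hτ, hκ0]
  have hτs : ∀ᶠ c in 𝓝 0, ContMDiffAt 𝓘(ℝ, EuclideanSpace ℝ (Fin d)) 𝓘(ℝ, EM) ∞ τ c := by
    filter_upwards [hLT.eventually hκs] with c hc
    exact ContMDiffAt.comp c hc L.contDiff.contMDiff.contMDiffAt
  have hτJ : ∀ᶠ c in 𝓝 0, J (τ c) = J x := hLT.eventually hJκ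
  have hτd : HasMFDerivAt 𝓘(ℝ, EuclideanSpace ℝ (Fin d)) 𝓘(ℝ, EM) τ 0 (K.subtypeL ∘L L) := by
    have h1 : HasMFDerivAt 𝓘(ℝ, K) 𝓘(ℝ, EM) κ (L 0) K.subtypeL := by rw [map_zero]; exact hκd
    exact HasMFDerivAt.comp (0 : EuclideanSpace ℝ (Fin d)) h1 L.hasFDerivAt.hasMFDerivAt
  have hact1 : ∀ g c, J (τ c) = J x → J (g • τ c) = act g (J x) := fun g c h => by
    rw [hequiv, h]
  -- the retraction
  obtain ⟨D₁, hD₁, hD₁'⟩ := hasMFDerivAt_smul_param γ.param_smooth hτs γ.param_zero hτ0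
    γ.param_deriv hτd hρ
  obtain ⟨R, hRs, hR⟩ := exists_smooth_local_retraction (0 : EG × EuclideanSpace ℝ (Fin d))
    (smul_param_smooth γ.param_smooth hτs) (by
      rw [hD₁.mfderiv]
      change Function.Injective D₁
      rw [injective_iff_map_eq_zero]
      rintro ⟨v, c⟩ h
      rw [hD₁'] at h
      obtain ⟨h1, h2⟩ := hL v c h
      rw [h1, h2]; rfl)
  have hpair : γ.param (0 : EG × EuclideanSpace ℝ (Fin d)).1 •
      τ (0 : EG × EuclideanSpace ℝ (Fin d)).2 = x := by
    simp [γ.param_zero, hτ0]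
  rw [hpair] at hRs
  refine ⟨τ, fun z => (R z).2, hτ0, hτs, hτJ, ?_, ?_, ?_⟩
  · filter_upwards [hRs] with z hz
    exact ContMDiffAt.comp z contDiff_snd.contMDiff.contMDiffAt hz
  · rw [← Prod.mk_zero_zero, nhds_prod_eq] at hR
    obtain ⟨p, hp, q, hq, hpq⟩ := Filter.eventually_prod_iff.1 hR
    refine ⟨{g | p (γ.coord g) ∧ γ.param (γ.coord g) = g},
      (γ.tendsto_coord.eventually hp).and γ.param_coord, ?_⟩
    filter_upwards [hq] with c hc g hg
    have := hpq hg.1 hc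
    rw [hg.2] at this
    rw [this]
  · obtain ⟨D₂, hD₂, hD₂'⟩ := hasMFDerivAt_smul_param hηs hτs hη0 hτ0 hηd hτd hρ
    have hΨs := smul_param_smooth hηs hτs
    -- `Ψ` lands in the fibre near `0`, and in the fibre coordinate `A` its derivative is the linear
    -- isomorphism `e`.
    set Ψ : N × EuclideanSpace ℝ (Fin d) → M := fun p => η p.1 • τ p.2 with hΨ
    have hΨ0 : Ψ 0 = x := by simp [hΨ, hη0, hτ0]
    have hΨT : Filter.Tendsto Ψ (𝓝 0) (𝓝 x) := by
      simpa only [hΨ0] using hΨs.self_of_nhds.continuousAt.tendsto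
    have hAΨs : ∀ᶠ p in 𝓝 (0 : N × EuclideanSpace ℝ (Fin d)),
        ContDiffAt ℝ ∞ (fun p => A (Ψ p)) p := by
      filter_upwards [hΨs, hΨT.eventually hAs] with p h1 h2
      exact contMDiffAt_iff_contDiffAt.1 (ContMDiffAt.comp p h2 h1)
    obtain ⟨A', hA'⟩ : ∃ A' : EM →L[ℝ] K, HasMFDerivAt 𝓘(ℝ, EM) 𝓘(ℝ, K) A x A' :=
      ⟨_, (hAs.self_of_nhds.mdifferentiableAt (by simp)).hasMFDerivAt⟩
    have hA'K : ∀ k : K, A' k = k := by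
      have h1 : HasMFDerivAt 𝓘(ℝ, EM) 𝓘(ℝ, K) A (κ 0) A' := by rw [hκ0]; exact hA'
      have h2 := HasMFDerivAt.comp (0 : K) h1 hκd
      have h3 := (hasMFDerivAt_id (I := 𝓘(ℝ, K)) (0 : K)).congr_of_eventuallyEq
        (f₁ := A ∘ κ) hAκ
      exact fun k => DFunLike.congr_fun (hasMFDerivAt_unique h2 h3) k
    have hAΨd : HasFDerivAt (fun p => A (Ψ p))
        (e : N × EuclideanSpace ℝ (Fin d) →L[ℝ] K) 0 := by
      have h1 : HasMFDerivAt 𝓘(ℝ, EM) 𝓘(ℝ, K) A (Ψ 0) A' := by rw [hΨ0]; exact hA'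
      have h2 : HasFDerivAt (fun p => A (Ψ p)) (A' ∘L D₂) 0 := hasMFDerivAt_iff_hasFDerivAt.1
        (HasMFDerivAt.comp (0 : N × EuclideanSpace ℝ (Fin d)) h1 hD₂)
      refine h2.congr_fderiv (ContinuousLinearMap.ext fun p => ?_)
      have h3 : D₂ p = (e p : K) := by
        rw [← Prod.mk.eta (p := p), hD₂', he]
        rfl
      rw [ContinuousLinearMap.comp_apply, h3]
      exact hA'K _
    obtain ⟨E, hE, hE0, -, hEs, -⟩ :=
      exists_openPartialHomeomorph_of_hasFDerivAt_equiv e hAΨs hAΨd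
    have hcond : ∀ᶠ p in 𝓝 (0 : N × EuclideanSpace ℝ (Fin d)), p ∈ E.source ∧
        J (Ψ p) = J x ∧ ContinuousAt Ψ p ∧ κ (A (Ψ p)) = Ψ p := by
      have h1 : Filter.Tendsto (Prod.fst : N × EuclideanSpace ℝ (Fin d) → N) (𝓝 0) (𝓝 0) :=
        continuous_fst.tendsto 0
      have h2 : Filter.Tendsto (Prod.snd : N × EuclideanSpace ℝ (Fin d) → _) (𝓝 0) (𝓝 0) :=
        continuous_snd.tendsto 0
      filter_upwards [E.open_source.mem_nhds hE0, h1.eventually hη, h2.eventually hτJ, hΨs,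
        hΨT.eventually hκA] with p h3 h4 h5 h6 h7
      have h8 : J (Ψ p) = J x := by
        change J (η p.1 • τ p.2) = J x
        rw [hact1 _ _ h5, h4, hone]
      exact ⟨h3, h8, h6.continuousAt, h7 h8⟩
    have hin : Filter.Tendsto (fun c : EuclideanSpace ℝ (Fin d) => ((0 : N), c)) (𝓝 0) (𝓝 0) :=
      (Continuous.prodMk continuous_const continuous_id).tendsto' _ _ rfl
    have hτT : Filter.Tendsto τ (𝓝 0) (𝓝 x) := by
      simpa only [hτ0] using hτs.self_of_nhds.continuousAt.tendsto
    filter_upwards [hin.eventually (eventually_eventually_nhds.2 hcond),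
      hτT.eventually (eventually_eventually_nhds.2 hκA), hτT.eventually hAs]
      with c₀ h1 h2 h3 W hW B hB
    have hη' : ∀ᶠ t in 𝓝 (0 : N), η t ∈ W := by
      have : Filter.Tendsto η (𝓝 0) (𝓝 1) := by
        simpa only [hη0] using hηs.self_of_nhds.continuousAt.tendsto
      exact this.eventually hW
    have hsrc := h1.self_of_nhds.1
    have hEc : E ((0 : N), c₀) = A (τ c₀) := by
      rw [hE]; simp [hΨ, hη0]
    have htgt : A (τ c₀) ∈ E.target := by rw [← hEc]; exact E.map_source hsrc
    have hlim : Filter.Tendsto (fun z => E.symm (A z)) (𝓝 (τ c₀)) (𝓝 ((0 : N), c₀)) := by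
      have h4 : Filter.Tendsto E.symm (𝓝 (A (τ c₀))) (𝓝 ((0 : N), c₀)) := by
        have := (E.continuousAt_symm htgt).tendsto
        rwa [← hEc, E.left_inv hsrc, hEc] at this
      exact h4.comp h3.continuousAt.tendsto
    have hprod : ∀ᶠ p in 𝓝 ((0 : N), c₀), η p.1 ∈ W ∧ p.2 ∈ B := by
      rw [nhds_prod_eq]
      exact hη'.prod_mk hB
    filter_upwards [hlim.eventually h1, hlim.eventually hprod, h2,
      h3.continuousAt.tendsto.eventually (E.open_target.mem_nhds htgt)] with z h5 h6 h7 h8 hz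
    refine ⟨_, h6.1, _, h6.2, ?_⟩
    -- Both `z` and this value of `Ψ` lie in the fibre and have the same coordinate, and `κ`
    -- recovers points of the fibre from `A`.
    have h9 : A (Ψ (E.symm (A z))) = A z := by rw [← hE]; exact E.right_inv h8
    have h10 := h5.2.2.2
    rw [h9, h7 hz] at h10
    exact h10

end Slice
end QuasiPoisson

/-! ### Slices to the G-orbits in J⁻¹(𝒪) for free and proper actions. -/

namespace QuasiPoisson
namespace HamiltonianSpace
section Slices

set_option linter.unusedSectionVars false

variable {ED : Type*} [NormedAddCommGroup ED] [NormedSpace ℝ ED]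
  {D : Type*} [TopologicalSpace D] [ChartedSpace ED D] [Group D]
  {EG : Type*} [NormedAddCommGroup EG] [NormedSpace ℝ EG] [FiniteDimensional ℝ EG]
  {G : Type*} [TopologicalSpace G] [ChartedSpace EG G] [Group G] [LieGroup 𝓘(ℝ, EG) ∞ G]
  {P : SplitManinPair ED D EG G}
  {ES : Type*} [NormedAddCommGroup ES] [NormedSpace ℝ ES] [FiniteDimensional ℝ ES]
  [ChartedSpace ES P.S] [IsManifold 𝓘(ℝ, ES) ∞ P.S]
  {EM : Type*} [NormedAddCommGroup EM] [NormedSpace ℝ EM] [FiniteDimensional ℝ EM]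
  {M : Type*} [TopologicalSpace M] [ChartedSpace EM M] [IsManifold 𝓘(ℝ, EM) ∞ M]
  [MulAction G M] [ContMDiffSMul 𝓘(ℝ, EG) 𝓘(ℝ, EM) ∞ G M]
  (H : HamiltonianSpace P ES EM M) {y : P.S}

/-- The Lie algebra of the stabilizer of `y` under the dressing action. -/
noncomputable def isotropyAlgebra (P : SplitManinPair ED D EG G) (ES : Type*) [NormedAddCommGroup ES]
    [NormedSpace ℝ ES] [ChartedSpace ES P.S] (y : P.S) : Submodule ℝ EG :=
  LinearMap.ker (mfderiv 𝓘(ℝ, EG) 𝓘(ℝ, ES) (fun g : G => P.incl g • y) 1).toLinearMap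

/-- The dimension of the reduced space. -/
noncomputable def reducedDim (_H : HamiltonianSpace P ES EM M) (y : P.S) : ℕ :=
  Module.finrank ℝ EM - (Module.finrank ℝ ES + Module.finrank ℝ (isotropyAlgebra P ES y))

/-- A slice to the orbits in `J⁻¹(𝒪)`, parametrized by an open subset of `ℝᵈ`, together with a
smooth map which recovers the parameter near the slice. -/
structure Slice (H : HamiltonianSpace P ES EM M) (y : P.S) (d : ℕ) where
  dom : Set (EuclideanSpace ℝ (Fin d))
  dom_open : IsOpen dom
  point : EuclideanSpace ℝ (Fin d) → H.Preimage y
  coord : M → EuclideanSpace ℝ (Fin d)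
  smooth_point : ∀ c ∈ dom, ContMDiffAt (𝓡 d) 𝓘(ℝ, EM) ∞ (fun c => (point c).1) c
  continuousAt_point : ∀ c ∈ dom, ContinuousAt point c
  smooth_coord : ∀ c ∈ dom, ∀ᶠ z in 𝓝 (point c).1, ContMDiffAt 𝓘(ℝ, EM) (𝓡 d) ∞ coord z
  injective : ∀ c ∈ dom, ∀ c' ∈ dom, ∀ g : G, g • point c = point c' → c = c'
  eventually_mem : ∀ c ∈ dom, ∀ B ∈ 𝓝 c, ∀ᶠ q in 𝓝 (point c),
    ∃ g : G, ∃ c' ∈ B, q = g • point c' ∧ coord q.1 = c'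

theorem injective_infAction (q : H.Preimage y) (hfree : ∀ g : G, g • q = q → g = 1) (v : EG)
    (hv : infAction EG G EM q.1 v = 0) : v = 0 :=
  injective_mfderiv_of_injective (contMDiff_orbit (EG := EG) (EM := EM) q.1)
    (fun (g : G) (x : M) => g • x) (fun g => contMDiff_translation EG g)
    (fun g h => mul_smul g h q.1)
    (fun g hg => hfree g (Subtype.ext (hg.trans (one_smul G q.1)))) v hv

/-- For a free and proper action, an element which moves a point close to `p` to another point
close to `p` is close to `1`. -/
theorem eventually_mem_of_smul_eq [ProperSMul G (H.Preimage y)] {p : H.Preimage y}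
    (hfree : ∀ g : G, g • p = p → g = 1) {W : Set G} (hW : W ∈ 𝓝 (1 : G)) :
    ∀ᶠ q in 𝓝 (p, p), ∀ g : G, g • q.2 = q.1 → g ∈ W := by
  -- Properness closes the set of pairs related by an element outside the interior of `W`; freeness
  -- keeps `(p, p)` out of it.
  have hcl : IsClosed ((fun q : G × H.Preimage y => (q.1 • q.2, q.2)) ''
      ((interior W)ᶜ ×ˢ Set.univ)) :=
    (ProperSMul.isProperMap_smul_pair (G := G) (X := H.Preimage y)).isClosedMap _
      (isOpen_interior.isClosed_compl.prod isClosed_univ)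
  have hp : (p, p) ∉ (fun q : G × H.Preimage y => (q.1 • q.2, q.2)) ''
      ((interior W)ᶜ ×ˢ Set.univ) := by
    rintro ⟨⟨g, q⟩, ⟨hg, -⟩, h⟩
    have h2 : q = p := congrArg Prod.snd h
    have h1 : g • q = p := congrArg Prod.fst h
    rw [h2] at h1
    exact hg (by rw [hfree g h1]; exact mem_interior_iff_mem_nhds.2 hW)
  filter_upwards [hcl.isOpen_compl.mem_nhds hp] with q hq g hg
  by_contra hgW
  exact hq ⟨(g, q.2), ⟨fun h => hgW (interior_subset h), trivial⟩, Prod.ext hg rfl⟩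

/-- A point `q` near the slice lies over `h • y` with `h` near `1`, as G → 𝒪 is open; then `h⁻¹ • q`
lies in the fibre over `y`, which `exists_fibre_slice` covers. Injectivity on orbits holds because
two slice points can only be related by an element of `W`, for which `r` recovers the parameter. -/
theorem exists_slice
    (hdress : ∀ a : D, ContMDiff 𝓘(ℝ, ES) 𝓘(ℝ, ES) ∞ (fun s : P.S => a • s))
    (horb : ContMDiff 𝓘(ℝ, EG) 𝓘(ℝ, ES) ∞ (fun g : G => P.incl g • y))
    (hreg : ∀ q : H.Preimage y, Function.Surjective (mfderiv 𝓘(ℝ, EM) 𝓘(ℝ, ES) H.J q.1))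
    [ProperSMul G (H.Preimage y)] (p : H.Preimage y) (hfree : ∀ g : G, g • p = p → g = 1)
    (hp : H.J p.1 = y) :
    ∃ s : H.Slice y (H.reducedDim y), 0 ∈ s.dom ∧ s.point 0 = p := by
  classical
  have := topologicalGroup_of_lieGroup 𝓘(ℝ, EG) (G := G) ∞
  obtain ⟨τ, r, hτ0, hτs, hτJ, hrs, ⟨W, hW, hrW⟩, hopen⟩ :=
    exists_fibre_slice H.J_smooth (fun (g : G) (s : P.S) => P.incl g • s)
      (fun g => hdress (P.incl g)) (fun g h s => by rw [map_mul, mul_smul])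
      (fun s => by rw [map_one, one_smul]) H.J_equivariant (x := p.1) (by rw [hp]; exact horb)
      (hreg p) (H.injective_infAction p hfree) (isotropyAlgebra P ES y)
      (by rw [hp]; exact fun v => Iff.rfl) (H.reducedDim y) rfl
  -- The default `p` only makes `σ` total; the domain will consist of parameters with `J (τ c) = y`.
  set σ : EuclideanSpace ℝ (Fin (H.reducedDim y)) → H.Preimage y := fun c =>
    if h : ∃ g : G, P.incl g • y = H.J (τ c) then ⟨τ c, h⟩ else p with hσdef
  have hσ : ∀ c, H.J (τ c) = y → (σ c).1 = τ c := by
    intro c hc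
    have h : ∃ g : G, P.incl g • y = H.J (τ c) := ⟨1, by rw [hc, map_one, one_smul]⟩
    exact congrArg Subtype.val (dif_pos h)
  rw [hp] at hτJ hopen
  have hσ0 : σ 0 = p := Subtype.ext (by rw [hσ 0 (by rw [hτ0, hp]), hτ0])
  -- The component in `𝒪` is locally constant, so continuity in the immersed topology reduces to
  -- continuity in M.
  have hcont : ∀ c, ContinuousAt τ c → (∀ᶠ c' in 𝓝 c, H.J (τ c') = y) → ContinuousAt σ c := by
    intro c hc hJ
    refine H.tendsto_preimage_iff.2 ⟨?_, ?_⟩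
    · rw [hσ c hJ.self_of_nhds]
      exact hc.tendsto.congr' (hJ.mono fun c' h => (hσ c' h).symm)
    · refine tendsto_const_nhds.congr' (hJ.mono fun c' h => Subtype.ext ?_)
      change H.J (σ c).1 = H.J (σ c').1
      rw [hσ c hJ.self_of_nhds, hσ c' h, hJ.self_of_nhds, h]
  have hτT : Filter.Tendsto τ (𝓝 0) (𝓝 p.1) := by
    simpa only [hτ0] using hτs.self_of_nhds.continuousAt.tendsto
  have hσT : Filter.Tendsto σ (𝓝 0) (𝓝 p) := by
    simpa only [hσ0] using (hcont 0 hτs.self_of_nhds.continuousAt hτJ).tendsto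
  obtain ⟨U₀, hU₀, hU₀o, h0U₀⟩ := eventually_nhds_iff.1
    (hτs.and (hτJ.and (hrW.and (hopen.and (hτT.eventually (eventually_eventually_nhds.2 hrs))))))
  have hprop : ∀ᶠ c in 𝓝 (0 : EuclideanSpace ℝ (Fin (H.reducedDim y))) ×ˢ 𝓝 0, ∀ g : G,
      g • σ c.2 = σ c.1 → g ∈ W := by
    have h1 := H.eventually_mem_of_smul_eq hfree hW
    rw [nhds_prod_eq] at h1
    exact (hσT.prodMap hσT).eventually h1
  obtain ⟨U₁, hU₁, hU₁'⟩ := Filter.eventually_prod_self_iff'.1 hprop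
  have hval : ∀ c ∈ U₀, (σ c).1 = τ c := fun c hc => hσ c (hU₀ c hc).2.1
  have hJU : ∀ c ∈ U₀, ∀ᶠ c' in 𝓝 c, H.J (τ c') = y := fun c hc => by
    filter_upwards [hU₀o.mem_nhds hc] with c' hc'
    exact (hU₀ c' hc').2.1
  refine ⟨⟨U₀ ∩ interior U₁, hU₀o.inter isOpen_interior, σ, r, ?_, ?_, ?_, ?_, ?_⟩,
    ⟨h0U₀, mem_interior_iff_mem_nhds.2 hU₁⟩, hσ0⟩
  · rintro c ⟨hc, -⟩
    exact (hU₀ c hc).1.congr_of_eventuallyEq ((hJU c hc).mono fun c' h => hσ c' h)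
  · rintro c ⟨hc, -⟩
    exact hcont c (hU₀ c hc).1.continuousAt (hJU c hc)
  · rintro c ⟨hc, -⟩
    rw [hval c hc]
    exact (hU₀ c hc).2.2.2.2
  · rintro c ⟨hc, hc1⟩ c' ⟨hc', hc1'⟩ g h
    have hg : g ∈ W := hU₁' c' (interior_subset hc1') c (interior_subset hc1) g h
    have h1 : g • τ c = τ c' := by
      rw [← hval c hc, ← hval c' hc', ← h]; rfl
    have h2 := (hU₀ c hc).2.2.1 g hg
    have h3 := (hU₀ c' hc').2.2.1 1 (mem_of_mem_nhds hW)
    rw [one_smul] at h3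
    rw [← h2, h1, h3]
  · rintro c ⟨hc, -⟩ B hB
    -- Both `h` and the element from the fibre slice are taken in `V`, so that their product lies in
    -- `W`, where `r` returns the slice parameter.
    obtain ⟨V, hV, hVW⟩ := exists_nhds_one_split hW
    have h1 := (hU₀ c hc).2.2.2.1 V hV (B ∩ U₀) (Filter.inter_mem hB (hU₀o.mem_nhds hc))
    have h2 : Filter.Tendsto (fun a : G × M => a.1⁻¹ • a.2) (𝓝 ((1 : G), τ c)) (𝓝 (τ c)) := by
      have h3 : Continuous (fun a : G × M => a.1⁻¹ • a.2) :=
        haveI := ContMDiffSMul.continuousSMul (G := G) (M := M) (I := 𝓘(ℝ, EG)) (I' := 𝓘(ℝ, EM)) ∞;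
        continuous_fst.inv.smul continuous_snd
      exact h3.tendsto' _ _ (by simp)
    have h4 := h2.eventually h1
    rw [nhds_prod_eq] at h4
    obtain ⟨a, ha, b, hb, hab⟩ := Filter.eventually_prod_iff.1 h4
    rw [← hval c hc] at hb
    filter_upwards [H.continuous_val.continuousAt.eventually hb,
      H.eventually_mem_orbit_image (by rw [hval c hc]; exact (hU₀ c hc).2.1)
        (Filter.inter_mem hV (Filter.eventually_iff.1 ha))] with q hq ⟨h, ⟨hhV, hha⟩, hh⟩
    obtain ⟨g, hg, c', ⟨hc'B, hc'U⟩, hz⟩ := hab hha hq (by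
      change H.J (h⁻¹ • q.1) = y
      rw [H.J_equivariant, ← hh, ← mul_smul, ← map_mul, inv_mul_cancel, map_one, one_smul])
    have hq' : q.1 = (h * g) • τ c' := by
      rw [mul_smul, ← hz, smul_inv_smul]
    refine ⟨h * g, c', hc'B, Subtype.ext ?_, ?_⟩
    · rw [H.val_smul, hval c' hc'U, hq']
    · rw [hq']
      exact (hU₀ c' hc'U).2.2.1 _ (hVW h hhV g hg)

end Slices
end HamiltonianSpace
end QuasiPoisson

/-! ### The smooth structure and Poisson bracket of the reduced space. -/

namespace QuasiPoisson

/-- A function which is smooth near a point agrees near that point with a smooth function. -/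
theorem exists_contMDiff_eventuallyEq {E : Type*} [NormedAddCommGroup E] [NormedSpace ℝ E]
    [FiniteDimensional ℝ E] {M : Type*} [TopologicalSpace M] [ChartedSpace E M]
    [IsManifold 𝓘(ℝ, E) ∞ M] [T2Space M] {x : M} {f : M → ℝ}
    (hf : ∀ᶠ z in 𝓝 x, ContMDiffAt 𝓘(ℝ, E) 𝓘(ℝ, ℝ) ∞ f z) :
    ∃ F : M → ℝ, ContMDiff 𝓘(ℝ, E) 𝓘(ℝ, ℝ) ∞ F ∧ ∀ᶠ z in 𝓝 x, F z = f z := by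
  obtain ⟨b, -, hb⟩ := (SmoothBumpFunction.nhds_basis_tsupport (I := 𝓘(ℝ, E)) x).mem_iff.1 hf
  refine ⟨fun z => b z • f z, contMDiff_of_tsupport fun z hz => ?_, ?_⟩
  · exact b.contMDiffAt.smul (hb (tsupport_smul_subset_left (⇑b) f hz))
  · filter_upwards [b.eventuallyEq_one] with z hz
    rw [hz]; simp

/-- Transport of a Poisson bracket along an isomorphism of algebras. -/
noncomputable def PoissonBracket.transport {A B : Type*} [CommRing A] [Algebra ℝ A] [CommRing B]
    [Algebra ℝ B] (e : A ≃ₐ[ℝ] B) (br : PoissonBracket B) : PoissonBracket A where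
  bracket := (br.bracket.compl₁₂ e.toLinearMap e.toLinearMap).compr₂ e.symm.toLinearMap
  bracket_self f := by simp [br.bracket_self]
  jacobi f g h := by
    apply e.injective
    simpa using br.jacobi (e f) (e g) (e h)
  leibniz f g h := by
    apply e.injective
    simpa using br.leibniz (e f) (e g) (e h)

theorem PoissonBracket.transport_apply {A B : Type*} [CommRing A] [Algebra ℝ A] [CommRing B]
    [Algebra ℝ B] (e : A ≃ₐ[ℝ] B) (br : PoissonBracket B) (f g : A) :
    e ((PoissonBracket.transport e br).bracket f g) = br.bracket (e f) (e g) := by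
  simp [PoissonBracket.transport]

namespace HamiltonianSpace
section Quotient

set_option linter.unusedSectionVars false

variable {ED : Type*} [NormedAddCommGroup ED] [NormedSpace ℝ ED]
  {D : Type*} [TopologicalSpace D] [ChartedSpace ED D] [Group D]
  {EG : Type*} [NormedAddCommGroup EG] [NormedSpace ℝ EG] [FiniteDimensional ℝ EG]
  {G : Type*} [TopologicalSpace G] [ChartedSpace EG G] [Group G] [LieGroup 𝓘(ℝ, EG) ∞ G]
  {P : SplitManinPair ED D EG G}
  {ES : Type*} [NormedAddCommGroup ES] [NormedSpace ℝ ES] [FiniteDimensional ℝ ES]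
  [ChartedSpace ES P.S] [IsManifold 𝓘(ℝ, ES) ∞ P.S]
  {EM : Type*} [NormedAddCommGroup EM] [NormedSpace ℝ EM] [FiniteDimensional ℝ EM]
  {M : Type*} [TopologicalSpace M] [ChartedSpace EM M] [IsManifold 𝓘(ℝ, EM) ∞ M]
  [MulAction G M] [ContMDiffSMul 𝓘(ℝ, EG) 𝓘(ℝ, EM) ∞ G M]
  {H : HamiltonianSpace P ES EM M} {y : P.S} {d : ℕ}

theorem proj_surjective : Function.Surjective (H.proj (y := y)) := Quotient.mk_surjective

theorem proj_eq_proj_iff {p q : H.Preimage y} : H.proj p = H.proj q ↔ ∃ g : G, g • q = p :=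
  Quotient.eq.trans Iff.rfl

theorem proj_smul (g : G) (p : H.Preimage y) : H.proj (g • p) = H.proj p :=
  proj_eq_proj_iff.2 ⟨g, rfl⟩

variable [ContinuousConstSMul G (H.Preimage y)]

theorem isOpenQuotientMap_proj : IsOpenQuotientMap (H.proj (y := y)) :=
  MulAction.isOpenQuotientMap_quotientMk

variable (H y) in
-- Every orbit meets J⁻¹(y), which carries the subspace topology of M and is thus second countable;
-- the quotient is its continuous image. With charts, Lindelöf will upgrade to second countable.
theorem lindelofSpace_reducedSpace [SecondCountableTopology M] :
    LindelofSpace (H.ReducedSpace y) := by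
  let f : {x : M // H.J x = y} → H.ReducedSpace y := fun x =>
    H.proj ⟨x.1, 1, by rw [x.2, map_one, one_smul]⟩
  have hf : Continuous f := by
    refine isOpenQuotientMap_proj.continuous.comp (continuous_iff_continuousAt.2 fun x =>
      H.tendsto_preimage_iff.2 ⟨continuous_subtype_val.continuousAt, ?_⟩)
    refine tendsto_const_nhds.congr fun z => Subtype.ext ?_
    exact x.2.trans z.2.symm
  have hs : Set.range f = Set.univ := by
    refine Set.eq_univ_of_forall fun q => ?_
    obtain ⟨p, rfl⟩ := proj_surjective q
    obtain ⟨g, hg⟩ := p.2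
    have h1 : H.J (g⁻¹ • p.1) = y := by
      rw [H.J_equivariant, ← hg, ← mul_smul, ← map_mul, inv_mul_cancel, map_one, one_smul]
    exact ⟨⟨g⁻¹ • p.1, h1⟩, proj_eq_proj_iff.2 ⟨g⁻¹, rfl⟩⟩
  rw [← isLindelof_univ_iff, ← hs]
  exact isLindelof_range hf

namespace Slice

theorem image_mem_nhds (s : H.Slice y d) {c : EuclideanSpace ℝ (Fin d)} (hc : c ∈ s.dom)
    {B : Set (EuclideanSpace ℝ (Fin d))} (hB : B ∈ 𝓝 c) :
    (fun c => H.proj (s.point c)) '' B ∈ 𝓝 (H.proj (s.point c)) := by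
  rw [← isOpenQuotientMap_proj.map_nhds_eq, Filter.mem_map]
  filter_upwards [s.eventually_mem c hc B hB] with q ⟨g, c', hc', hq, _⟩
  exact ⟨c', hc', by rw [hq, proj_smul]⟩

theorem injOn_proj (s : H.Slice y d) : Set.InjOn (fun c => H.proj (s.point c)) s.dom := by
  intro c hc c' hc' h
  obtain ⟨g, hg⟩ := proj_eq_proj_iff.1 h
  exact (s.injective c' hc' c hc g hg).symm

/-- The local parametrization of the reduced space given by a slice. -/
noncomputable def param (s : H.Slice y d) :
    OpenPartialHomeomorph (EuclideanSpace ℝ (Fin d)) (H.ReducedSpace y) :=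
  OpenPartialHomeomorph.ofContinuousOpenRestrict s.injOn_proj.toPartialEquiv
    (fun c hc => (isOpenQuotientMap_proj.continuous.continuousAt.comp
      (s.continuousAt_point c hc)).continuousWithinAt)
    (by
      rw [isOpenMap_iff_nhds_le]
      rintro ⟨c, hc⟩ A hA
      have h1 : Subtype.val '' (Set.domRestrict s.dom (fun c => H.proj (s.point c)) ⁻¹' A) ∈ 𝓝 c := by
        exact (s.dom_open.isOpenEmbedding_subtypeVal.image_mem_nhds (x := ⟨c, hc⟩)).2 hA
      refine Filter.mem_of_superset (s.image_mem_nhds hc h1) ?_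
      rintro _ ⟨_, ⟨c', hc', rfl⟩, rfl⟩
      exact hc')
    s.dom_open

theorem param_apply (s : H.Slice y d) (c) : s.param c = H.proj (s.point c) := rfl

/-- The inverse of the parametrization lifts locally to a smooth map on `M`. -/
theorem exists_smooth_lift (s : H.Slice y d) {p : H.Preimage y} (hp : H.proj p ∈ s.param.target) :
    ∃ R : M → EuclideanSpace ℝ (Fin d),
      (∀ᶠ z in 𝓝 p.1, ContMDiffAt 𝓘(ℝ, EM) (𝓡 d) ∞ R z) ∧
      ∀ᶠ q in 𝓝 p, s.param.symm (H.proj q) = R q.1 := by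
  set c := s.param.symm (H.proj p) with hcdef
  have hc : c ∈ s.dom := s.param.map_target hp
  have hcp : H.proj (s.point c) = H.proj p := s.param.right_inv hp
  obtain ⟨g, hg⟩ := proj_eq_proj_iff.1 hcp
  have h1 : Filter.Tendsto (fun z : M => g • z) (𝓝 p.1) (𝓝 (s.point c).1) := by
    rw [← hg]
    exact (contMDiff_translation (EM := EM) EG g).continuous.continuousAt
  have h2 : Filter.Tendsto (fun q : H.Preimage y => g • q) (𝓝 p) (𝓝 (s.point c)) := by
    rw [← hg]
    exact (continuous_const_smul g).continuousAt
  -- A fixed `g` carries `p` onto the slice, near which `s.coord` reads off the parameter of the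
  -- orbit.
  refine ⟨fun z => s.coord (g • z), ?_, ?_⟩
  · filter_upwards [h1.eventually (s.smooth_coord c hc)] with z hz
    exact ContMDiffAt.comp z hz (contMDiff_translation (EM := EM) EG g z)
  · filter_upwards [h2.eventually (s.eventually_mem c hc _ (s.dom_open.mem_nhds hc))]
      with q ⟨g', c', hc', hq, hcq⟩
    have h3 : H.proj q = s.param c' := by
      rw [s.param_apply, ← proj_smul g, hq, proj_smul]
    rw [h3, s.param.left_inv hc', ← hcq]
    rfl

/-- Near each point the transition passes through M: the smooth slice map of `s` followed by a
smooth lift of the inverse parametrization of `s'`. -/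
theorem contDiffOn_transition (s s' : H.Slice y d) :
    ContDiffOn ℝ ∞ (s.param ≫ₕ s'.param.symm) (s.param ≫ₕ s'.param.symm).source := by
  rintro c ⟨hc, hc'⟩
  obtain ⟨R, hR, hRs⟩ := s'.exists_smooth_lift (p := s.point c) hc'
  have h1 : ContMDiffAt (𝓡 d) (𝓡 d) ∞ (fun c => R (s.point c).1) c :=
    ContMDiffAt.comp c hR.self_of_nhds (s.smooth_point c hc)
  refine (contMDiffAt_iff_contDiffAt.1 (h1.congr_of_eventuallyEq ?_)).contDiffWithinAt
  filter_upwards [(s.continuousAt_point c hc).tendsto.eventually hRs] with c' h2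
  exact h2

end Slice

section Atlas

variable (hs : ∀ q : H.ReducedSpace y, ∃ s : H.Slice y d, q ∈ s.param.target)

/-- The atlas of the reduced space given by a family of slices. -/
@[reducible] noncomputable def reducedChartedSpace :
    ChartedSpace (EuclideanSpace ℝ (Fin d)) (H.ReducedSpace y) where
  atlas := Set.range fun q => (hs q).choose.param.symm
  chartAt q := (hs q).choose.param.symm
  mem_chart_source q := (hs q).choose_spec
  chart_mem_atlas q := ⟨q, rfl⟩

theorem isManifold_reducedSpace :
    letI := reducedChartedSpace hs
    IsManifold (𝓡 d) ∞ (H.ReducedSpace y) := by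
  letI := reducedChartedSpace hs
  refine isManifold_of_contDiffOn _ _ _ ?_
  rintro _ _ ⟨q, rfl⟩ ⟨q', rfl⟩
  have h := (hs q).choose.contDiffOn_transition (hs q').choose
  simpa using h

include hs in
theorem secondCountable_reducedSpace [SecondCountableTopology M] :
    SecondCountableTopology (H.ReducedSpace y) := by
  letI := reducedChartedSpace hs
  have := H.lindelofSpace_reducedSpace y
  obtain ⟨t, htc, ht⟩ := countable_cover_nhds fun q : H.ReducedSpace y =>
    chart_source_mem_nhds (EuclideanSpace ℝ (Fin d)) q
  exact ChartedSpace.secondCountable_of_countable_cover _ ht htc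

/-- Forwards, the pull-back is locally `h` in a chart composed with the lift `R`, and a bump
function extends this from a neighbourhood to all of M. Backwards, `h` in a chart is an extension F
of its pull-back, restricted to the slice. -/
theorem contMDiff_iff_isSmooth [T2Space M] (h : H.ReducedSpace y → ℝ) :
    letI := reducedChartedSpace hs
    ContMDiff (𝓡 d) 𝓘(ℝ, ℝ) ∞ h ↔ IsSmooth (fun p : H.Preimage y => h (H.proj p)) := by
  letI := reducedChartedSpace hs
  have := isManifold_reducedSpace hs
  constructor
  · intro hh p
    set e := chartAt (EuclideanSpace ℝ (Fin d)) (H.proj p) with he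
    obtain ⟨R, hR, hRs⟩ := (hs (H.proj p)).choose.exists_smooth_lift (hs (H.proj p)).choose_spec
    have hsrc : H.proj p ∈ e.source := mem_chart_source _ _
    have hRp : e (H.proj p) = R p.1 := hRs.self_of_nhds
    have hRc : Filter.Tendsto R (𝓝 p.1) (𝓝 (e (H.proj p))) := by
      rw [hRp]; exact hR.self_of_nhds.continuousAt
    obtain ⟨F, hF, hFR⟩ := exists_contMDiff_eventuallyEq (x := p.1) (f := fun z => h (e.symm (R z)))
      (by
        filter_upwards [hR, hRc.eventually (e.open_target.mem_nhds (e.map_source hsrc))] with z h1 h2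
        have h3 : ContMDiffAt (𝓡 d) (𝓡 d) ∞ e.symm (R z) :=
          contMDiffAt_symm_of_mem_maximalAtlas (IsManifold.chart_mem_maximalAtlas _) h2
        exact (hh _).comp z (h3.comp z h1))
    refine ⟨F, hF, ?_⟩
    filter_upwards [H.continuous_val.continuousAt.eventually hFR, hRs,
      isOpenQuotientMap_proj.continuous.continuousAt.eventually (e.open_source.mem_nhds hsrc)]
      with q h1 h2 h3
    rw [h1, ← h2]
    exact congrArg h (e.left_inv h3)
  · intro hh q
    set s := (hs q).choose with hsdef
    set c := s.param.symm q with hcdef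
    have hq : q ∈ s.param.target := (hs q).choose_spec
    have hc : c ∈ s.dom := s.param.map_target hq
    obtain ⟨F, hF, hFh⟩ := hh (s.point c)
    have h1 : ContMDiffAt (𝓡 d) 𝓘(ℝ, ℝ) ∞ (fun c => h (s.param c)) c := by
      refine ((hF _).comp c (s.smooth_point c hc)).congr_of_eventuallyEq ?_
      filter_upwards [(s.continuousAt_point c hc).tendsto.eventually hFh] with c' h2
      exact h2.symm
    have h2 : ContMDiffAt (𝓡 d) (𝓡 d) ∞ s.param.symm q :=
      contMDiffAt_of_mem_maximalAtlas
        (IsManifold.subset_maximalAtlas (show s.param.symm ∈ atlas _ _ from ⟨q, rfl⟩)) hq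
    refine (ContMDiffAt.comp q h1 h2).congr_of_eventuallyEq ?_
    filter_upwards [s.param.open_target.mem_nhds hq] with q' hq'
    exact congrArg h (s.param.right_inv hq').symm

end Atlas

section PoissonStructure

variable [ChartedSpace (EuclideanSpace ℝ (Fin d)) (H.ReducedSpace y)]

/-- Smooth functions on the reduced space are the invariant smooth functions on `J⁻¹(𝒪)`. -/
noncomputable def pullbackEquiv
    (hsm : ∀ h : H.ReducedSpace y → ℝ, ContMDiff (𝓡 d) 𝓘(ℝ, ℝ) ∞ h ↔
      IsSmooth (fun p : H.Preimage y => h (H.proj p))) :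
    C^∞⟮𝓡 d, H.ReducedSpace y; ℝ⟯ ≃ₐ[ℝ] H.invariantFunctions y where
  toFun h := ⟨fun p => h (H.proj p), (hsm h).1 h.contMDiff, fun g p => congrArg h (proj_smul g p)⟩
  invFun f :=
    ⟨Quotient.lift f.1 fun a b hab => by
      obtain ⟨g, rfl⟩ := (MulAction.orbitRel_apply (G := G)).1 hab
      exact f.2.2 g b, (hsm _).2 f.2.1⟩
  left_inv h := by
    ext q
    obtain ⟨p, rfl⟩ := proj_surjective q
    rfl
  right_inv f := rfl
  map_mul' h k := rfl
  map_add' h k := rfl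
  commutes' r := rfl

/-- Pull-back is an isomorphism of algebras, so the bracket transports; surjectivity of the
projection gives uniqueness. -/
theorem existsUnique_reducedPoisson
    (hsm : ∀ h : H.ReducedSpace y → ℝ, ContMDiff (𝓡 d) 𝓘(ℝ, ℝ) ∞ h ↔
      IsSmooth (fun p : H.Preimage y => h (H.proj p)))
    (br : PoissonBracket (H.invariantFunctions y)) :
    ∃! brQ : PoissonBracket C^∞⟮𝓡 d, H.ReducedSpace y; ℝ⟯,
      ∀ (h k : C^∞⟮𝓡 d, H.ReducedSpace y; ℝ⟯) (f g : H.invariantFunctions y),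
        (∀ p, f.1 p = h (H.proj p)) → (∀ p, g.1 p = k (H.proj p)) →
        ∀ p, brQ.bracket h k (H.proj p) = (br.bracket f g).1 p := by
  refine ⟨PoissonBracket.transport (pullbackEquiv hsm) br, ?_, ?_⟩
  · intro h k f g hf hg p
    have hf' : f = pullbackEquiv hsm h := Subtype.ext (funext hf)
    have hg' : g = pullbackEquiv hsm k := Subtype.ext (funext hg)
    rw [hf', hg', ← PoissonBracket.transport_apply]
    rfl
  · intro br' hbr'
    ext h k q
    obtain ⟨p, rfl⟩ := proj_surjective q
    rw [hbr' h k (pullbackEquiv hsm h) (pullbackEquiv hsm k) (fun _ => rfl) (fun _ => rfl) p,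
      ← PoissonBracket.transport_apply]
    rfl

end PoissonStructure
end Quotient
end HamiltonianSpace
end QuasiPoisson

/-! ### Covering the reduced space by slices, and conclusion. -/

namespace QuasiPoisson
namespace HamiltonianSpace
section Reduction

set_option linter.unusedSectionVars false

variable {ED : Type*} [NormedAddCommGroup ED] [NormedSpace ℝ ED]
  {D : Type*} [TopologicalSpace D] [ChartedSpace ED D] [Group D]
  {EG : Type*} [NormedAddCommGroup EG] [NormedSpace ℝ EG] [FiniteDimensional ℝ EG]
  {G : Type*} [TopologicalSpace G] [ChartedSpace EG G] [Group G] [LieGroup 𝓘(ℝ, EG) ∞ G]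
  {P : SplitManinPair ED D EG G}
  {ES : Type*} [NormedAddCommGroup ES] [NormedSpace ℝ ES] [FiniteDimensional ℝ ES]
  [ChartedSpace ES P.S] [IsManifold 𝓘(ℝ, ES) ∞ P.S]
  {EM : Type*} [NormedAddCommGroup EM] [NormedSpace ℝ EM] [FiniteDimensional ℝ EM]
  {M : Type*} [TopologicalSpace M] [ChartedSpace EM M] [IsManifold 𝓘(ℝ, EM) ∞ M]
  [MulAction G M] [ContMDiffSMul 𝓘(ℝ, EG) 𝓘(ℝ, EM) ∞ G M]
  (H : HamiltonianSpace P ES EM M) {y : P.S}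

/-- If the action on `J⁻¹(𝒪)` is free and proper, the reduced space is covered by slices. -/
theorem exists_slice_of_reducedSpace
    (hdress : ∀ a : D, ContMDiff 𝓘(ℝ, ES) 𝓘(ℝ, ES) ∞ (fun s : P.S => a • s))
    (horb : ContMDiff 𝓘(ℝ, EG) 𝓘(ℝ, ES) ∞ (fun g : G => P.incl g • y))
    (hreg : ∀ q : H.Preimage y, Function.Surjective (mfderiv 𝓘(ℝ, EM) 𝓘(ℝ, ES) H.J q.1))
    (hfree : ∀ (g : G) (p : H.Preimage y), g • p = p → g = 1) [ProperSMul G (H.Preimage y)]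
    (q : H.ReducedSpace y) : ∃ s : H.Slice y (H.reducedDim y), q ∈ s.param.target := by
  obtain ⟨p, rfl⟩ := proj_surjective q
  obtain ⟨g, hg⟩ := p.2
  have hJ : H.J (g⁻¹ • p).1 = y := by
    rw [H.val_smul, H.J_equivariant, ← hg, ← mul_smul, ← map_mul, inv_mul_cancel, map_one,
      one_smul]
  -- Slices are built only at points over `y`; translating `p` there does not change its class.
  obtain ⟨s, hs, hsp⟩ := H.exists_slice hdress horb hreg (g⁻¹ • p) (fun h => hfree h _) hJ
  refine ⟨s, ?_⟩
  rw [← proj_smul g⁻¹ p, ← hsp]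
  exact s.param.map_source hs

end Reduction
end HamiltonianSpace
end QuasiPoisson

theorem proposition4p15
    {ED : Type*} [NormedAddCommGroup ED] [NormedSpace ℝ ED] [FiniteDimensional ℝ ED]
    {D : Type*} [TopologicalSpace D] [ChartedSpace ED D] [Group D] [LieGroup 𝓘(ℝ, ED) ∞ D]
    [ConnectedSpace D]
    {EG : Type*} [NormedAddCommGroup EG] [NormedSpace ℝ EG] [FiniteDimensional ℝ EG]
    {G : Type*} [TopologicalSpace G] [ChartedSpace EG G] [Group G] [LieGroup 𝓘(ℝ, EG) ∞ G]
    [ConnectedSpace G]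
    (P : QuasiPoisson.SplitManinPair ED D EG G)
    -- the smooth structure of `S = D / G`: the one for which `D → D / G` is a submersion
    {ES : Type*} [NormedAddCommGroup ES] [NormedSpace ℝ ES] [FiniteDimensional ℝ ES]
    [ChartedSpace ES P.S] [IsManifold 𝓘(ℝ, ES) ∞ P.S]
    (hS_smooth : ContMDiff 𝓘(ℝ, ED) 𝓘(ℝ, ES) ∞ (fun a : D => (a : P.S)))
    (hS_submersion : ∀ a : D,
      Function.Surjective (mfderiv 𝓘(ℝ, ED) 𝓘(ℝ, ES) (fun a : D => (a : P.S)) a))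
    {EM : Type*} [NormedAddCommGroup EM] [NormedSpace ℝ EM] [FiniteDimensional ℝ EM]
    {M : Type*} [TopologicalSpace M] [ChartedSpace EM M] [IsManifold 𝓘(ℝ, EM) ∞ M]
    [T2Space M] [SecondCountableTopology M]
    [MulAction G M] [ContMDiffSMul 𝓘(ℝ, EG) 𝓘(ℝ, EM) ∞ G M]
    (H : QuasiPoisson.HamiltonianSpace P ES EM M)
    (y : P.S) (hy : H.IsRegularValue y) :
    ∃ br : QuasiPoisson.PoissonBracket (H.invariantFunctions y),
      H.IsReducedBracket br ∧
      (∀ br' : QuasiPoisson.PoissonBracket (H.invariantFunctions y),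
        H.IsReducedBracket br' → br' = br) ∧
      -- if `G` acts freely and properly on `J⁻¹(𝒪)`, then `J⁻¹(𝒪) / G` is a Poisson manifold
      ((∀ (g : G) (p : H.Preimage y), g • p = p → g = 1) → ProperSMul G (H.Preimage y) →
        ∃ (d : ℕ) (_ : ChartedSpace (EuclideanSpace ℝ (Fin d)) (H.ReducedSpace y)),
          IsManifold (𝓡 d) ∞ (H.ReducedSpace y) ∧
          T2Space (H.ReducedSpace y) ∧ SecondCountableTopology (H.ReducedSpace y) ∧
          (∀ h : H.ReducedSpace y → ℝ,
            ContMDiff (𝓡 d) 𝓘(ℝ, ℝ) ∞ h ↔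
              QuasiPoisson.HamiltonianSpace.IsSmooth (fun p : H.Preimage y => h (H.proj p))) ∧
          ∃! brQ : QuasiPoisson.PoissonBracket C^∞⟮𝓡 d, H.ReducedSpace y; ℝ⟯,
            ∀ (h k : C^∞⟮𝓡 d, H.ReducedSpace y; ℝ⟯) (f g : H.invariantFunctions y),
              (∀ p, f.1 p = h (H.proj p)) → (∀ p, g.1 p = k (H.proj p)) →
              ∀ p, brQ.bracket h k (H.proj p) = (br.bracket f g).1 p) := by
  have hdress := QuasiPoisson.contMDiff_dressing P hS_smooth hS_submersion
  have horb := QuasiPoisson.contMDiff_dressing_orbit P hS_smooth y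
  have hreg := H.surjective_mfderiv_J hdress hy
  refine ⟨H.reducedBracket hreg, H.isReducedBracket_reducedBracket hreg,
    fun br' h => QuasiPoisson.HamiltonianSpace.IsReducedBracket.unique
      (H.isReducedBracket_reducedBracket hreg) h, fun hfree hprop => ?_⟩
  have hs := H.exists_slice_of_reducedSpace hdress horb hreg hfree
  have hsm := QuasiPoisson.HamiltonianSpace.contMDiff_iff_isSmooth hs
  letI := QuasiPoisson.HamiltonianSpace.reducedChartedSpace hs
  exact ⟨H.reducedDim y, this, QuasiPoisson.HamiltonianSpace.isManifold_reducedSpace hs,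
    t2Space_quotient_mulAction_of_properSMul,
    QuasiPoisson.HamiltonianSpace.secondCountable_reducedSpace hs, hsm,
    QuasiPoisson.HamiltonianSpace.existsUnique_reducedPoisson hsm (H.reducedBracket hreg)⟩
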